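/- **Setting.** Let $\mathcal X\subset\mathbb R^n$ be a measurable state space of finite Lebesgue measure, $\mathcal X_{obs}$ a relatively open subset of $\mathcal X$, $\mathcal X_{free}=\mathcal X\setminus\mathcal X_{obs}$, $x_{start}\in\mathcal X_{free}$, $x_{goal}\in\mathcal X_{goal}\subset\mathcal X_{free}$. Let $\mathcal U\subset\mathbb R^m$ be a nonempty measurable control set of finite Lebesgue measure all of whose nonempty relatively open subsets have positive measure. Let $f:\mathcal X\times\mathcal U\to\mathbb R^n$ be Lipschitz in $x$ uniformly in $u$ and Lipschitz in $u$ uniformly in $x$ (Euclidean norms), and consider $\dot x=f(x,u)$. A *valid trajectory* is a continuous curve $[0,T]\to\mathcal X_{free}$ obtained by integrating the system under some measurable control function $[0,T]\to\mathcal U$. **Algorithm GABRRT.** Parameters: $T_{max},\delta_{hr},\epsilon>0$, $\gamma\in\mathbb R$, $N_B\in\mathbb N$, an exploitation ratio $\mathcal P:\{1,2,\dots\}\to[0,1]$, cost functions on edges, a function $d_X:\mathcal X\times\mathcal X\to\mathbb R$ satisfying the triangle inequality, and a function $d^{ND}_X$ which satisfies the triangle inequality and depends only on a chosen subset of the coordinates.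 The forward tree starts at $x_{start}$, the reverse tree at $x_{goal}$, and the priority queue $Q$ of forward nodes is empty; $g$ and $h$ denote the accumulated cost from the start, resp. to the goal, along the trees. "Random state" means uniform on $\mathcal X$; "propagation from $x$" means integrating $\dot x=f(x,u)$ from $x$ with a constant control $u$ uniform on $\mathcal U$ for a time uniform on $[0,T_{max}]$ (it yields no edge if the curve leaves $\mathcal X$); all draws are independent. Nearest nodes in the forward tree to a random state are taken with respect to $d_X$, all other nearest nodes with respect to $d_X^{ND}$. Iteration $k=1,2,\dots$: 1. Put $r_k=\min\bigl(\gamma(\log|V_{rev}|/|V_{rev}|)^{1/(n+1)},\delta_{hr}\bigr)$. Draw a random state, take the nearest node $x_{near}$ of the reverse tree, and move from $x_{near}$ straight towards the random state by at most $\epsilon$. If the segment lies in $\mathcal X_{free}$, add it and its new endpoint $x_{rev}$ to the reverse tree, and if the forward node $x_c$ closest to $x_{rev}$ satisfies $d^{ND}_X(x_c,x_{rev})\le r_k$ and lies in $Q$, lower its key to $d^{ND}_X(x_c,x_{rev})+h(x_{rev})$ if this is smaller. 2. Draw $c_{rand}$ uniformly on $[0,1]$. If $c_{rand}<\mathcal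 P(k)$: pop the least-key node $x_{pop}$ of $Q$ (if any); let $x_{best}$ minimise $g(x_{pop})+d^{ND}_X(x_{pop},x)+h(x)$ over reverse nodes $x$ with $d_X^{ND}(x_{pop},x)\le r_k$; among $N_B$ propagations from $x_{pop}$ choose the edge whose final node is $d^{ND}_X$-closest to $x_{best}$. If no edge results (fast exploration): draw a random state and choose, among $N_B$ propagations from its nearest forward node, the edge whose final node is $d_X$-closest to it. If $c_{rand}\ge\mathcal P(k)$ or there is still no edge (*random exploration*): draw a random state and take one propagation from its nearest forward node. 3. If the resulting edge exists and lies in $\mathcal X_{free}$, add it and its final node $x_{for}$ to the forward tree. If $x_{for}\in\mathcal X_{goal}$, stop and return the path. Otherwise, if the closest reverse node $x_c$ has $d^{ND}_X(x_{for},x_c)\le r_k$, insert $x_{for}$ into $Q$ with key $d^{ND}_X(x_{for},x_c)+h(x_c)$. After stopping, the trees no longer change. **Corollary (GABRRT is probabilistically complete).** Assume that * there is $q<1$ with $0\le\mathcal P(k)\le q$ for all $k\ge1$; * $d_X$ is compatible with the Euclidean topology: for every $p\in\mathcal X$ and $\varepsilon>0$ there is $\eta>0$ such that, for $x,y\in\mathcal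 X$, $\|x-p\|<\eta$ and $\|y-p\|<\eta$ imply $d_X(x,y)<\varepsilon$, and $d_X(x,p)<\eta$ implies $\|x-p\|<\varepsilon$ (for example, $d_X$ is the Euclidean distance); * the problem has a robust solution: a valid trajectory that starts at $x_{start}$, ends in the interior of $\mathcal X_{goal}$, and for some $\delta>0$ has all the balls of radius $\delta$ around its points contained in $\mathcal X_{free}$. Then in each iteration the criterion for random exploration ($c_{rand}\ge\mathcal P(k)$, or exploitation and fast exploration yield no edge) holds with probability at least $1-q>0$, and, with $V_N$ and $E_N$ the nodes and edges of the forward tree after $N$ iterations, $$\liminf_{N\to\infty}\mathbb P\bigl(\exists\,x_g\in\mathcal X_{goal}\cap V_N:\ x_{start}\text{ is connected to }x_g\text{ by a finite sequence of valid trajectories from }E_N\bigr)=1 .$$ Equivalently, the probability of the complementary event tends to $0$. -/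

import Mathlib

open MeasureTheory ProbabilityTheory Filter Topology

noncomputable section

namespace GABRRT

/-- Points of `ℝⁿ` with the Euclidean norm. -/
abbrev E (n : ℕ) : Type := EuclideanSpace ℝ (Fin n)

/-- A parametrised curve together with its duration; only `path` on `[0, dur]` matters. -/
structure Traj (n : ℕ) where
  dur : ℝ
  path : ℝ → E n

/-- The initial node of an edge. -/
def Traj.init {n : ℕ} (e : Traj n) : E n := e.path 0

/-- The final node of an edge. -/
def Traj.final {n : ℕ} (e : Traj n) : E n := e.path e.dur

/-- The data of a single-query feasible motion planning problem for the control system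
`x' = f (x, u)` (together with the root `xgoal` of the reverse tree). -/
structure Problem (n m : ℕ) where
  /-- state space -/
  X : Set (E n)
  /-- obstacle space -/
  Xobs : Set (E n)
  /-- goal region -/
  Xgoal : Set (E n)
  xstart : E n
  xgoal : E n
  /-- input control set -/
  U : Set (E m)
  /-- dynamics; only its values on `X × U` matter -/
  f : E n → E m → E n

namespace Problem

variable {n m : ℕ}

/-- The free space. -/
def Xfree (P : Problem n m) : Set (E n) := P.X \ P.Xobs

/-- The standing assumptions on the planning problem. -/
structure Admissible (P : Problem n m) : Prop where
  measurableSet_X : MeasurableSet P.X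
  volume_X_lt_top : volume P.X < ⊤
  isOpen_obs : ∃ O : Set (E n), IsOpen O ∧ P.Xobs = P.X ∩ O
  start_mem : P.xstart ∈ P.Xfree
  goal_mem : P.xgoal ∈ P.Xgoal
  goal_subset : P.Xgoal ⊆ P.Xfree
  measurableSet_U : MeasurableSet P.U
  U_nonempty : P.U.Nonempty
  volume_U_lt_top : volume P.U < ⊤
  /-- `U` is genuinely `m`-dimensional near each of its points -/
  volume_U_pos : ∀ u ∈ P.U, ∀ r : ℝ, 0 < r → 0 < volume (P.U ∩ Metric.ball u r)
  lipschitz_state : ∃ Kx : ℝ, 0 < Kx ∧ ∀ x₁ ∈ P.X, ∀ x₂ ∈ P.X, ∀ u ∈ P.U,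
    ‖P.f x₁ u - P.f x₂ u‖ ≤ Kx * ‖x₁ - x₂‖
  lipschitz_control : ∃ Ku : ℝ, 0 < Ku ∧ ∀ x ∈ P.X, ∀ u₁ ∈ P.U, ∀ u₂ ∈ P.U,
    ‖P.f x u₁ - P.f x u₂‖ ≤ Ku * ‖u₁ - u₂‖

/-- `e` is obtained by forward integration of `x' = f (x, υ)` over `[0, e.dur]`. -/
def Integrates (P : Problem n m) (υ : ℝ → E m) (e : Traj n) : Prop :=
  ContinuousOn e.path (Set.Icc 0 e.dur) ∧
  IntervalIntegrable (fun s => P.f (e.path s) (υ s)) volume 0 e.dur ∧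
  ∀ t ∈ Set.Icc 0 e.dur, e.path t = e.path 0 + ∫ s in (0 : ℝ)..t, P.f (e.path s) (υ s)

/-- The collision check is passed: the whole curve lies in the free space. -/
def CollisionFree (P : Problem n m) (e : Traj n) : Prop :=
  ∀ s ∈ Set.Icc 0 e.dur, e.path s ∈ P.Xfree

/-- Valid trajectories: curves in the free space generated by the system under some
(measurable) control function with values in `U`. -/
def IsValid (P : Problem n m) (e : Traj n) : Prop :=
  0 ≤ e.dur ∧ P.CollisionFree e ∧
  ∃ υ : ℝ → E m, Measurable υ ∧ (∀ s ∈ Set.Icc 0 e.dur, υ s ∈ P.U) ∧ P.Integrates υ e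

/-- The trajectory has clearance at least `δ`. -/
def HasClearance (P : Problem n m) (e : Traj n) (δ : ℝ) : Prop :=
  ∀ t ∈ Set.Icc 0 e.dur, Metric.ball (e.path t) δ ⊆ P.Xfree

/-- There is a solution of the planning problem with positive clearance that ends in the interior
of the goal region. -/
def RobustlySolvable (P : Problem n m) : Prop :=
  ∃ e : Traj n, P.IsValid e ∧ e.init = P.xstart ∧ e.final ∈ interior P.Xgoal ∧
    ∃ δ : ℝ, 0 < δ ∧ P.HasClearance e δ

/-- `b` is reached from `a` by a feasible path: a finite sequence of valid trajectories from the
edge set `𝓔`, each starting where the previous one ends. -/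
def Connected (P : Problem n m) (𝓔 : Set (Traj n)) (a b : E n) : Prop :=
  Relation.ReflTransGen (fun x y => ∃ e ∈ 𝓔, P.IsValid e ∧ e.init = x ∧ e.final = y) a b

end Problem

/-- The user-chosen inputs and parameters of the algorithm. -/
structure Params (n : ℕ) where
  /-- maximum propagation time -/
  Tmax : ℝ
  /-- heuristic radius -/
  δhr : ℝ
  /-- constant in the shrinking radius -/
  γ : ℝ
  /-- maximum length of a reverse (straight-line) edge -/
  ε : ℝ
  /-- number of best-input propagation trajectories -/
  NB : ℕ
  /-- exploitation ratio function -/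
  ratio : ℕ → ℝ
  /-- distance function on the state space -/
  dX : E n → E n → ℝ
  /-- the coordinates that are kept when higher-order dynamics are dropped -/
  pos : Finset (Fin n)
  /-- distance function on the space of the kept coordinates -/
  dpos : (pos → ℝ) → (pos → ℝ) → ℝ
  /-- cost of forward edges -/
  cost : Traj n → ℝ
  /-- cost of (non-dynamical) reverse edges -/
  costND : Traj n → ℝ

/-- The non-dynamical distance function, read on states. -/
def Params.dND {n : ℕ} (A : Params n) (x y : E n) : ℝ :=
  A.dpos (fun i => x i) (fun i => y i)

/-- Assumptions on the parameters: positivity, the triangle inequality for the distance functions,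
and compatibility of `dX` with the Euclidean topology of the state space: near a point `p`
all `dX`-distances are small, and states that are `dX`-close to `p` are close to `p`. -/
structure Params.Admissible {n : ℕ} (A : Params n) (X : Set (E n)) : Prop where
  Tmax_pos : 0 < A.Tmax
  δhr_pos : 0 < A.δhr
  ε_pos : 0 < A.ε
  triangle : ∀ x ∈ X, ∀ y ∈ X, ∀ z ∈ X, A.dX x z ≤ A.dX x y + A.dX y z
  triangle_pos : ∀ x y z, A.dpos x z ≤ A.dpos x y + A.dpos y z
  small_near : ∀ p ∈ X, ∀ ε : ℝ, 0 < ε → ∃ η : ℝ, 0 < η ∧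
    ∀ x ∈ X, ∀ y ∈ X, ‖x - p‖ < η → ‖y - p‖ < η → A.dX x y < ε
  near_of_small : ∀ p ∈ X, ∀ ε : ℝ, 0 < ε → ∃ η : ℝ, 0 < η ∧
    ∀ x ∈ X, A.dX x p < η → ‖x - p‖ < ε

/-- The random numbers drawn in one iteration: the random state of the reverse search; `c_rand`;
the `NB` pairs (duration, control) of the exploitation search; the random state and the `NB` pairs
of the fast exploration; the random state and the pair of the random exploration. (A draw that the
iteration does not use is ignored.) -/
abbrev Sample (n m N : ℕ) : Type :=
  E n × ℝ × (Fin N → ℝ × E m) × (E n × (Fin N → ℝ × E m)) × (E n × (ℝ × E m))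

namespace Sample

variable {n m N : ℕ}

def xRev (w : Sample n m N) : E n := w.1
def c (w : Sample n m N) : ℝ := w.2.1
def exploit (w : Sample n m N) : Fin N → ℝ × E m := w.2.2.1
def xFast (w : Sample n m N) : E n := w.2.2.2.1.1
def fast (w : Sample n m N) : Fin N → ℝ × E m := w.2.2.2.1.2
def xRand (w : Sample n m N) : E n := w.2.2.2.2.1
def rand (w : Sample n m N) : ℝ × E m := w.2.2.2.2.2

end Sample

section Laws

variable {n m : ℕ}

/-- The uniform distribution on the state space. -/
def stateLaw (P : Problem n m) : Measure (E n) := cond volume P.X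

/-- A duration uniform on `[0, Tmax]` and an independent control uniform on `U`. -/
def propLaw (P : Problem n m) (A : Params n) : Measure (ℝ × E m) :=
  (cond volume (Set.Icc (0 : ℝ) A.Tmax)).prod (cond volume P.U)

/-- The joint law of the independent draws of one iteration; `c_rand` is uniform on `[0, 1]`. -/
def sampleLaw (P : Problem n m) (A : Params n) : Measure (Sample n m A.NB) :=
  (stateLaw P).prod ((cond volume (Set.Icc (0 : ℝ) 1)).prod
    ((Measure.pi fun _ : Fin A.NB => propLaw P A).prod
      (((stateLaw P).prod (Measure.pi fun _ : Fin A.NB => propLaw P A)).prod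
        ((stateLaw P).prod (propLaw P A)))))

end Laws

/-- The state of the algorithm. -/
structure State (n : ℕ) where
  /-- nodes of the forward tree -/
  Vfor : List (E n)
  /-- edges of the forward tree -/
  Efor : Set (Traj n)
  /-- cost-from-start of the forward nodes -/
  g : E n → ℝ
  /-- nodes of the reverse tree -/
  Vrev : List (E n)
  /-- edges of the reverse tree -/
  Erev : Set (Traj n)
  /-- cost-to-goal of the reverse nodes -/
  h : E n → ℝ
  /-- priority queue: pairs (forward node, key) -/
  Q : List (E n × ℝ)
  /-- a path has been returned -/
  finished : Prop

section Algorithm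

open Classical

variable {n m : ℕ}

/-- The initial state. -/
def initState (P : Problem n m) : State n where
  Vfor := [P.xstart]
  Efor := ∅
  g := fun _ => 0
  Vrev := [P.xgoal]
  Erev := ∅
  h := fun _ => 0
  Q := []
  finished := False

/-- The shrinking radius. -/
def radius (A : Params n) (s : State n) : ℝ :=
  min (A.γ * (Real.log s.Vrev.length / s.Vrev.length) ^ (1 / ((n : ℝ) + 1))) A.δhr

/-- Monte Carlo propagation: the trajectory from `x` for the time `w.1` under the constant control
`w.2` (unique by the Lipschitz assumption); `none` if it leaves the state space. -/
def monteCarloProp (P : Problem n m) (x : E n) (w : ℝ × E m) : Option (Traj n) :=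
  if h : ∃ e : Traj n, e.dur = w.1 ∧ e.init = x ∧ (∀ s ∈ Set.Icc 0 e.dur, e.path s ∈ P.X) ∧
      P.Integrates (fun _ => w.2) e
  then some h.choose else none

/-- Best-input propagation with respect to the distance function `d`: among the trajectories
generated by the draws `w`, the one whose final node is closest to `y`. -/
def bestInputProp (P : Problem n m) (d : E n → E n → ℝ) {N : ℕ} (x y : E n)
    (w : Fin N → ℝ × E m) : Option (Traj n) :=
  ((List.ofFn w).filterMap (monteCarloProp P x)).argmin fun e => d e.final y

/-- Fast exploration of the forward tree. -/
def forSrchFastExplore (P : Problem n m) (A : Params n) (s : State n)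
    (w : Sample n m A.NB) : Option (Traj n) :=
  (s.Vfor.argmin fun v => A.dX v w.xFast).bind fun xnear =>
    bestInputProp P A.dX xnear w.xFast w.fast

/-- Random exploration of the forward tree. -/
def forSrchRandomExplore (P : Problem n m) (A : Params n) (s : State n)
    (w : Sample n m A.NB) : Option (Traj n) :=
  (s.Vfor.argmin fun v => A.dX v w.xRand).bind fun xnear => monteCarloProp P xnear w.rand

/-- Exploitation search from the popped node, guided by the non-dynamical reverse tree. -/
def forSrchExploitND (P : Problem n m) (A : Params n) (r : ℝ) (s : State n)
    (w : Sample n m A.NB) (xpop : E n) : Option (Traj n) :=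
  ((s.Vrev.filter fun x => A.dND xpop x ≤ r).argmin
      fun x => s.g xpop + A.dND xpop x + s.h x).bind fun xbest =>
    bestInputProp P A.dND xpop xbest w.exploit

/-- The straight segment between `xnear` and the point at distance at most `ε` from `xnear`
towards `xrand`. It is oriented towards the goal: its initial node is the new node. -/
def extend (A : Params n) (xnear xrand : E n) : Traj n :=
  let xnew := xnear + min 1 (A.ε / ‖xrand - xnear‖) • (xrand - xnear)
  { dur := 1, path := fun t => xnew + t • (xnear - xnew) }

/-- `UpdatePQueueND`: lowers the key of the forward node closest to `xrev`, if that node is within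
radius `r` and is in the queue with a larger key. -/
def updatePQueueND (A : Params n) (r : ℝ) (xrev : E n) (s : State n) : State n :=
  match s.Vfor.argmin fun v => A.dND v xrev with
  | none => s
  | some xc =>
    if A.dND xc xrev ≤ r then
      { s with Q := s.Q.map fun p =>
          if p.1 = xc then (p.1, min p.2 (A.dND xc xrev + s.h xrev)) else p }
    else s

/-- `insertToPQueueND`: inserts the new forward node if the closest reverse node is within
radius `r`. -/
def insertToPQueueND (A : Params n) (r : ℝ) (xfor : E n) (s : State n) : State n :=
  match s.Vrev.argmin fun v => A.dND xfor v with
  | none => s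
  | some xc =>
    if A.dND xfor xc ≤ r then { s with Q := (xfor, A.dND xfor xc + s.h xc) :: s.Q } else s

/-- Expansion of the non-dynamical reverse tree. -/
def revExpand (P : Problem n m) (A : Params n) (r : ℝ) (w : Sample n m A.NB) (s : State n) :
    State n :=
  match s.Vrev.argmin fun v => A.dND w.xRev v with
  | none => s
  | some xnear =>
    let e := extend A xnear w.xRev
    if P.CollisionFree e then
      updatePQueueND A r e.init
        { s with
          Vrev := s.Vrev.insert e.init
          Erev := insert e s.Erev
          h := Function.update s.h e.init (A.costND e + s.h xnear) }
    else s

/-- Removes a node with least key from the queue. -/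
def pop (Q : List (E n × ℝ)) : Option (E n × List (E n × ℝ)) :=
  (Q.argmin fun p => p.2).map fun p => (p.1, Q.erase p)

/-- The part of the forward expansion governed by `c_rand < q`: the exploitation search from the
popped node and, failing that, the fast exploration; also returns the remaining queue. -/
def exploitOrFast (P : Problem n m) (A : Params n) (q r : ℝ) (w : Sample n m A.NB)
    (s : State n) : Option (Traj n) × List (E n × ℝ) :=
  if w.c < q then
    match pop s.Q with
    | none => (forSrchFastExplore P A s w, s.Q)
    | some (xpop, Q') =>
      ((forSrchExploitND P A r s w xpop).or (forSrchFastExplore P A s w), Q')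
  else (none, s.Q)

/-- Addition of a collision-free edge to the forward tree, with the test whether the goal region is
reached. -/
def addForward (P : Problem n m) (A : Params n) (r : ℝ) (e : Traj n) (s : State n) : State n :=
  if P.CollisionFree e then
    let s' : State n :=
      { s with
        Vfor := s.Vfor.insert e.final
        Efor := insert e s.Efor
        g := Function.update s.g e.final (s.g e.init + A.cost e) }
    if e.final ∈ P.Xgoal then { s' with finished := True }
    else insertToPQueueND A r e.final s'
  else s

/-- Expansion of the forward tree. -/
def forExpand (P : Problem n m) (A : Params n) (q r : ℝ) (w : Sample n m A.NB) (s : State n) :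
    State n :=
  let a := exploitOrFast P A q r w s
  let s' : State n := { s with Q := a.2 }
  match a.1.or (forSrchRandomExplore P A s w) with
  | none => s'
  | some e => addForward P A r e s'

/-- The `k`-th iteration; nothing happens once a path has been returned. -/
def step (P : Problem n m) (A : Params n) (k : ℕ) (w : Sample n m A.NB) (s : State n) : State n :=
  if s.finished then s
  else forExpand P A (A.ratio k) (radius A s) w (revExpand P A (radius A s) w s)

/-- The state after `k` iterations, driven by the draws `ξ 0, ξ 1, …`. -/
def run (P : Problem n m) (A : Params n) (ξ : ℕ → Sample n m A.NB) : ℕ → State n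
  | 0 => initState P
  | k + 1 => step P A (k + 1) (ξ k) (run P A ξ k)

/-- In the `k`-th iteration from the state `s`, the forward edge is generated by random exploration:
`c_rand ≥ q`, or neither exploitation nor fast exploration has produced an edge. -/
def UsesRandomExplore (P : Problem n m) (A : Params n) (k : ℕ) (w : Sample n m A.NB)
    (s : State n) : Prop :=
  A.ratio k ≤ w.c ∨
    (exploitOrFast P A (A.ratio k) (radius A s) w (revExpand P A (radius A s) w s)).1 = none

/-- The forward tree contains a goal node that is connected to the start. -/
def Success (P : Problem n m) (s : State n) : Prop :=
  ∃ xg ∈ P.Xgoal, xg ∈ s.Vfor ∧ P.Connected s.Efor P.xstart xg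

end Algorithm

end GABRRT

end

/-!
A forward tree that grows by random exploration with probability bounded below follows any
trajectory with clearance.

Along the robust solution `x`, the measurable control is replaced by a piecewise constant one, one
piece per edge (`exists_density_of_control`). A curve with constant control stays close to `x` up to
the integrated mismatch of velocities (`norm_sub_le_of_integral_eq`), so this yields a finite chain
of edges that keeps a positive clearance and ends in the goal region.

Along each edge of the chain, from `z` to `z'` say, a neighbourhood of `z'` is attained from a
neighbourhood of `z` in a single iteration: if `c_rand ≥ q`, the random state is near `z`, and the
duration and control are near those of the edge, then the node selected by `dX` is near `z`
(`exists_argmin_near`), and its propagation is collision-free and ends near `z'`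
(`exists_monteCarloProp_near`). Compatibility of `dX` with the topology gives no rate, so
the neighbourhoods are chosen backwards along an exact chain of edges. The draws that achieve
the passage form a fixed set of positive probability, whatever the tree and the queue look like; by
the second Borel–Cantelli lemma they occur after any given iteration
(`AlmostSurelyAttained.of_step`).
Induction along the chain shows that almost surely a goal node is found
(`exists_almostSurelyAttained_near_final`). It is connected to the start because every edge is
valid (`TreeInvariant`).

Nothing is assumed about the measurability of the distance and cost functions. The success events
are therefore bounded from below by measurable events defined by the draws `ξ k`.
-/

namespace GABRRT

/-! ### Integral curves -/

lemma one_le_exp_two_mul_one_sub {a : ℝ} (ha : 0 ≤ a) (ha' : a ≤ 1 / 2) :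
    1 ≤ Real.exp (2 * a) * (1 - a) := by
  have h := Real.add_one_le_exp (2 * a)
  nlinarith

/-- Grönwall-type comparison on a short interval. The curve `y` integrates the field `F`, the curve
`x` is an arbitrary absolutely continuous curve. Since `K * h ≤ 1 / 2`, the bound follows by
estimating the maximum of `‖y - x‖` by itself, and no differential inequality is needed. -/
lemma norm_sub_le_of_integral_eq {V : Type*} [NormedAddCommGroup V] [NormedSpace ℝ V]
    [CompleteSpace V] {F : V → V} {g x y : ℝ → V} {X : Set V} {K h : ℝ} (hK : 0 ≤ K) (hh : 0 ≤ h)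
    (hKh : K * h ≤ 1 / 2) (hF : ∀ p ∈ X, ∀ q ∈ X, ‖F p - F q‖ ≤ K * ‖p - q‖)
    (hxc : ContinuousOn x (Set.Icc 0 h)) (hyc : ContinuousOn y (Set.Icc 0 h))
    (hxX : ∀ t ∈ Set.Icc 0 h, x t ∈ X) (hyX : ∀ t ∈ Set.Icc 0 h, y t ∈ X)
    (hg : IntervalIntegrable g volume 0 h)
    (hx : ∀ t ∈ Set.Icc 0 h, x t = x 0 + ∫ s in (0 : ℝ)..t, g s)
    (hy : ∀ t ∈ Set.Icc 0 h, y t = y 0 + ∫ s in (0 : ℝ)..t, F (y s)) :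
    ∀ t ∈ Set.Icc 0 h, ‖y t - x t‖ ≤
      Real.exp (2 * (K * h)) * (‖y 0 - x 0‖ + ∫ s in (0 : ℝ)..h, ‖F (x s) - g s‖) := by
  have hFc : ContinuousOn F X := by
    have : LipschitzOnWith ⟨K, hK⟩ F X := LipschitzOnWith.of_dist_le_mul fun p hp q hq => by
      rw [dist_eq_norm, dist_eq_norm]; exact hF p hp q hq
    exact this.continuousOn
  have hFx : ContinuousOn (fun s => F (x s)) (Set.Icc 0 h) := hFc.comp hxc hxX
  have hFy : ContinuousOn (fun s => F (y s)) (Set.Icc 0 h) := hFc.comp hyc hyX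
  have hIx : IntervalIntegrable (fun s => F (x s)) volume 0 h :=
    hFx.intervalIntegrable_of_Icc hh
  have hIy : IntervalIntegrable (fun s => F (y s)) volume 0 h :=
    hFy.intervalIntegrable_of_Icc hh
  obtain ⟨t₀, ht₀, hmax⟩ := isCompact_Icc.exists_isMaxOn (Set.nonempty_Icc.2 hh)
    ((hyc.sub hxc).norm)
  set M := ‖y t₀ - x t₀‖ with hM
  have hmax' : ∀ t ∈ Set.Icc 0 h, ‖y t - x t‖ ≤ M := fun t ht => hmax ht
  set A := ‖y 0 - x 0‖ + ∫ s in (0 : ℝ)..h, ‖F (x s) - g s‖ with hA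
  have key : M ≤ A + K * h * M := by
    have hsub : Set.uIcc 0 t₀ ⊆ Set.uIcc 0 h := by
      rw [Set.uIcc_of_le ht₀.1, Set.uIcc_of_le hh]; exact Set.Icc_subset_Icc_right ht₀.2
    have i1 := hIx.mono_set hsub
    have i2 := hIy.mono_set hsub
    have i3 := hg.mono_set hsub
    have e : y t₀ - x t₀ = (y 0 - x 0) + (∫ s in (0 : ℝ)..t₀, (F (y s) - F (x s)))
        + ∫ s in (0 : ℝ)..t₀, (F (x s) - g s) := by
      rw [hx t₀ ht₀, hy t₀ ht₀, intervalIntegral.integral_sub i2 i1,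
        intervalIntegral.integral_sub i1 i3]
      abel
    have b1 : ‖∫ s in (0 : ℝ)..t₀, (F (y s) - F (x s))‖ ≤ K * M * |t₀ - 0| := by
      refine intervalIntegral.norm_integral_le_of_norm_le_const fun s hs => ?_
      rw [Set.uIoc_of_le ht₀.1] at hs
      have hs' : s ∈ Set.Icc 0 h := ⟨hs.1.le, hs.2.trans ht₀.2⟩
      exact (hF _ (hyX s hs') _ (hxX s hs')).trans
        (mul_le_mul_of_nonneg_left (hmax' s hs') hK)
    have b2 : ‖∫ s in (0 : ℝ)..t₀, (F (x s) - g s)‖ ≤ ∫ s in (0 : ℝ)..h, ‖F (x s) - g s‖ := by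
      refine (intervalIntegral.norm_integral_le_integral_norm ht₀.1).trans ?_
      refine intervalIntegral.integral_mono_interval le_rfl ht₀.1 ht₀.2 ?_ (hIx.sub hg).norm
      exact Eventually.of_forall fun s => norm_nonneg _
    have b3 : K * M * |t₀ - 0| ≤ K * h * M := by
      rw [sub_zero, abs_of_nonneg ht₀.1]
      nlinarith [mul_nonneg hK (norm_nonneg (y t₀ - x t₀)), ht₀.2]
    calc M = ‖(y 0 - x 0) + (∫ s in (0 : ℝ)..t₀, (F (y s) - F (x s)))
        + ∫ s in (0 : ℝ)..t₀, (F (x s) - g s)‖ := by rw [hM, e]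
      _ ≤ _ := norm_add₃_le
      _ ≤ A + K * h * M := by rw [hA]; linarith
  intro t ht
  refine (hmax' t ht).trans ?_
  have h1 := one_le_exp_two_mul_one_sub (mul_nonneg hK hh) hKh
  have hM0 : 0 ≤ M := norm_nonneg _
  have h3 : M * (1 - K * h) ≤ A := by linarith
  calc M ≤ M * (Real.exp (2 * (K * h)) * (1 - K * h)) := le_mul_of_one_le_right hM0 h1
    _ = Real.exp (2 * (K * h)) * (M * (1 - K * h)) := by ring
    _ ≤ _ := by gcongr

/-- A globally Lipschitz field has integral curves up to time `1 / (2 * K)`, whatever the initial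
point. -/
lemma exists_integral_curve {V : Type*} [NormedAddCommGroup V] [NormedSpace ℝ V]
    [CompleteSpace V] {F : V → V} {K : NNReal} (hF : LipschitzWith K F) {h : ℝ} (hh : 0 ≤ h)
    (hKh : K * h ≤ 1 / 2) (x₀ : V) :
    ∃ y : ℝ → V, y 0 = x₀ ∧ ContinuousOn y (Set.Icc 0 h) ∧
      ∀ t ∈ Set.Icc 0 h, y t = y 0 + ∫ s in (0 : ℝ)..t, F (y s) := by
  -- On the ball of radius `a` the field is bounded by `‖F x₀‖ + K * a`, so a curve started at the
  -- centre cannot leave the ball before time `h`.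
  set a : NNReal := ⟨2 * h * ‖F x₀‖, by positivity⟩ with ha
  set L : NNReal := ‖F x₀‖₊ + K * a with hL
  have hPL : IsPicardLindelof (fun _ : ℝ => F) (tmin := 0) (tmax := h) ⟨0, le_rfl, hh⟩
      x₀ a 0 L K := by
    refine IsPicardLindelof.of_time_independent ?_ (hF.lipschitzOnWith) ?_
    · intro x hx
      have h1 := hF.norm_sub_le x x₀
      have h2 : ‖x - x₀‖ ≤ a := by simpa [dist_eq_norm] using hx
      have h3 : ‖F x‖ ≤ ‖F x - F x₀‖ + ‖F x₀‖ := norm_le_norm_sub_add _ _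
      have h4 : (K : ℝ) * ‖x - x₀‖ ≤ K * a := by gcongr
      simp only [hL, NNReal.coe_add, NNReal.coe_mul, coe_nnnorm]
      linarith
    · have : (a : ℝ) = 2 * h * ‖F x₀‖ := rfl
      simp only [hL, NNReal.coe_add, NNReal.coe_mul, coe_nnnorm, sub_zero, NNReal.coe_zero,
        sub_self, max_eq_left hh]
      have h5 : (K : ℝ) * h * a ≤ 1 / 2 * a := by gcongr
      nlinarith
  obtain ⟨y, hy0, hy⟩ := hPL.exists_eq_forall_mem_Icc_hasDerivWithinAt₀
  have hyc : ContinuousOn y (Set.Icc 0 h) := fun t ht => (hy t ht).continuousWithinAt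
  refine ⟨y, hy0, hyc, fun t ht => ?_⟩
  have hsub : Set.Icc 0 t ⊆ Set.Icc 0 h := Set.Icc_subset_Icc_right ht.2
  have := intervalIntegral.integral_eq_sub_of_hasDerivAt_of_le ht.1 (hyc.mono hsub)
    (f' := fun s => F (y s)) (fun s hs => (hy s (hsub ⟨hs.1.le, hs.2.le⟩)).hasDerivAt
      (Icc_mem_nhds hs.1 (hs.2.trans_le ht.2)))
    ((hF.continuous.comp_continuousOn (hyc.mono hsub)).intervalIntegrable_of_Icc ht.1)
  rw [this]; abel

namespace Problem

variable {n m : ℕ}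

/-- Every field `f (·, u)` with `u ∈ U` is the restriction to the state space of a globally
`K`-Lipschitz field. -/
def HasLipschitzExtension (P : Problem n m) (K : NNReal) : Prop :=
  ∀ u ∈ P.U, ∃ F : E n → E n, LipschitzWith K F ∧ ∀ x ∈ P.X, F x = P.f x u

lemma Admissible.exists_hasLipschitzExtension {P : Problem n m} (hP : P.Admissible) :
    ∃ K : NNReal, P.HasLipschitzExtension K := by
  obtain ⟨Kx, hKx, hL⟩ := hP.lipschitz_state
  refine ⟨lipschitzExtensionConstant (E n) * ⟨Kx, hKx.le⟩, fun u hu => ?_⟩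
  have : LipschitzOnWith ⟨Kx, hKx.le⟩ (fun x => P.f x u) P.X :=
    LipschitzOnWith.of_dist_le_mul fun p hp q hq => by
      rw [dist_eq_norm, dist_eq_norm]; exact hL p hp q hq u hu
  obtain ⟨F, hF, hFe⟩ := this.extend_finite_dimension
  exact ⟨F, hF, fun x hx => (hFe hx).symm⟩

lemma HasLipschitzExtension.norm_sub_le {P : Problem n m} {K : NNReal}
    (hK : P.HasLipschitzExtension K) {u : E m} (hu : u ∈ P.U) :
    ∀ p ∈ P.X, ∀ q ∈ P.X, ‖P.f p u - P.f q u‖ ≤ K * ‖p - q‖ := by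
  obtain ⟨F, hF, hFe⟩ := hK u hu
  intro p hp q hq
  rw [← hFe p hp, ← hFe q hq]
  exact hF.norm_sub_le p q

/-- A curve produced by a constant control is at most as far from a reference curve `x` with
velocity `g` as its initial deviation and the integrated velocity mismatch allow. -/
lemma HasLipschitzExtension.norm_sub_le_of_integrates {P : Problem n m} {K : NNReal}
    (hK : P.HasLipschitzExtension K) {u : E m} (hu : u ∈ P.U) {e : Traj n} (he0 : 0 ≤ e.dur)
    (hKh : K * e.dur ≤ 1 / 2) (he : P.Integrates (fun _ => u) e)
    (heX : ∀ t ∈ Set.Icc 0 e.dur, e.path t ∈ P.X) {x g : ℝ → E n}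
    (hxc : ContinuousOn x (Set.Icc 0 e.dur)) (hxX : ∀ t ∈ Set.Icc 0 e.dur, x t ∈ P.X)
    (hg : IntervalIntegrable g volume 0 e.dur)
    (hx : ∀ t ∈ Set.Icc 0 e.dur, x t = x 0 + ∫ s in (0 : ℝ)..t, g s) :
    ∀ t ∈ Set.Icc 0 e.dur, ‖e.path t - x t‖ ≤ Real.exp (2 * (K * e.dur)) *
      (‖e.init - x 0‖ + ∫ s in (0 : ℝ)..e.dur, ‖P.f (x s) u - g s‖) :=
  norm_sub_le_of_integral_eq (F := fun p => P.f p u) K.2 he0 hKh (hK.norm_sub_le hu) hxc he.1 hxX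
    heX hg hx he.2.2

/-- In a tube of radius `δ` around a reference curve, a constant control can be integrated as
long as the comparison estimate keeps the curve inside the tube. The curve is integrated for the
globally Lipschitz extension of the field, for which the comparison holds unconditionally; being
in the tube, it then never sees the extension. -/
lemma HasLipschitzExtension.exists_integrates {P : Problem n m} {K : NNReal}
    (hK : P.HasLipschitzExtension K) {u : E m} (hu : u ∈ P.U) {h δ : ℝ} (hh : 0 ≤ h)
    (hKh : K * h ≤ 1 / 2) {x g : ℝ → E n} (hxc : ContinuousOn x (Set.Icc 0 h))
    (hδ : 0 < δ) (hxX : ∀ t ∈ Set.Icc 0 h, Metric.ball (x t) δ ⊆ P.Xfree)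
    (hg : IntervalIntegrable g volume 0 h)
    (hx : ∀ t ∈ Set.Icc 0 h, x t = x 0 + ∫ s in (0 : ℝ)..t, g s) {x₀ : E n}
    (hx₀ : Real.exp (2 * (K * h)) *
      (‖x₀ - x 0‖ + ∫ s in (0 : ℝ)..h, ‖P.f (x s) u - g s‖) < δ) :
    ∃ e : Traj n, e.dur = h ∧ e.init = x₀ ∧ P.Integrates (fun _ => u) e ∧
      P.CollisionFree e := by
  obtain ⟨F, hF, hFe⟩ := hK u hu
  obtain ⟨y, hy0, hyc, hy⟩ := exists_integral_curve hF hh hKh x₀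
  have hxX' : ∀ t ∈ Set.Icc 0 h, x t ∈ P.X := fun t ht =>
    (hxX t ht (Metric.mem_ball_self hδ)).1
  have hint : ∫ s in (0 : ℝ)..h, ‖F (x s) - g s‖ = ∫ s in (0 : ℝ)..h, ‖P.f (x s) u - g s‖ := by
    refine intervalIntegral.integral_congr fun s hs => ?_
    rw [Set.uIcc_of_le hh] at hs
    simp only [hFe _ (hxX' s hs)]
  have hyx := norm_sub_le_of_integral_eq (X := Set.univ) K.2 hh hKh
    (fun p _ q _ => hF.norm_sub_le p q) hxc hyc (fun _ _ => trivial) (fun _ _ => trivial) hg hx hy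
  rw [hint, hy0] at hyx
  have hyfree : ∀ t ∈ Set.Icc 0 h, y t ∈ P.Xfree := fun t ht =>
    hxX t ht (by rw [Metric.mem_ball, dist_eq_norm]; exact (hyx t ht).trans_lt hx₀)
  have hFy : ∀ t ∈ Set.Icc 0 h, F (y t) = P.f (y t) u := fun t ht => hFe _ (hyfree t ht).1
  refine ⟨⟨h, y⟩, rfl, hy0, ⟨hyc, ?_, fun t ht => ?_⟩, hyfree⟩
  · refine ContinuousOn.intervalIntegrable_of_Icc hh ?_
    exact (hF.continuous.comp_continuousOn hyc).congr fun t ht => (hFy t ht).symm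
  · change y t = _
    rw [hy t ht]
    congr 1
    refine intervalIntegral.integral_congr fun s hs => ?_
    rw [Set.uIcc_of_le ht.1] at hs
    exact hFy s ⟨hs.1, hs.2.trans ht.2⟩

end Problem

end GABRRT

namespace GABRRT

/-! ### Invariants of the algorithm -/

section Invariants

variable {n m : ℕ} {P : Problem n m} {A : Params n}

/-- `e` starts at `x` and is generated by a constant control in `U`; it may still collide with the
obstacles. -/
def IsPropagation (P : Problem n m) (x : E n) (e : Traj n) : Prop :=
  e.init = x ∧ 0 ≤ e.dur ∧ ∃ u ∈ P.U, P.Integrates (fun _ => u) e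

/-- A draw of (duration, control) in the range of the uniform distributions. -/
def IsPropDraw (P : Problem n m) (p : ℝ × E m) : Prop := 0 ≤ p.1 ∧ p.2 ∈ P.U

/-- All durations and controls drawn in an iteration are in range. This holds almost surely, and is
what makes every edge of the forward tree a trajectory of the system: a curve of negative duration
would pass the collision check vacuously. -/
def IsValidSample (P : Problem n m) {N : ℕ} (w : Sample n m N) : Prop :=
  (∀ i, IsPropDraw P (w.exploit i)) ∧ (∀ i, IsPropDraw P (w.fast i)) ∧ IsPropDraw P w.rand

lemma monteCarloProp_spec {x : E n} {w : ℝ × E m} {e : Traj n}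
    (h : monteCarloProp P x w = some e) :
    e.dur = w.1 ∧ e.init = x ∧ (∀ s ∈ Set.Icc 0 e.dur, e.path s ∈ P.X) ∧
      P.Integrates (fun _ => w.2) e := by
  unfold monteCarloProp at h
  split_ifs at h with hex
  obtain rfl := Option.some.inj h
  exact hex.choose_spec

lemma monteCarloProp_eq_some_of_exists {x : E n} {w : ℝ × E m}
    (h : ∃ e : Traj n, e.dur = w.1 ∧ e.init = x ∧ (∀ s ∈ Set.Icc 0 e.dur, e.path s ∈ P.X) ∧
      P.Integrates (fun _ => w.2) e) : ∃ e, monteCarloProp P x w = some e := by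
  unfold monteCarloProp
  rw [dif_pos h]
  exact ⟨_, rfl⟩

lemma isPropagation_of_monteCarloProp {x : E n} {w : ℝ × E m} {e : Traj n}
    (hw : IsPropDraw P w) (h : monteCarloProp P x w = some e) : IsPropagation P x e := by
  obtain ⟨h1, h2, _, h4⟩ := monteCarloProp_spec h
  exact ⟨h2, h1 ▸ hw.1, w.2, hw.2, h4⟩

lemma isPropagation_of_bestInputProp {d : E n → E n → ℝ} {N : ℕ} {x y : E n}
    {w : Fin N → ℝ × E m} {e : Traj n} (hw : ∀ i, IsPropDraw P (w i))
    (h : bestInputProp P d x y w = some e) : IsPropagation P x e := by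
  have h1 := List.argmin_mem h
  rw [List.mem_filterMap] at h1
  obtain ⟨p, hp, hpe⟩ := h1
  rw [List.mem_ofFn] at hp
  obtain ⟨i, rfl⟩ := hp
  exact isPropagation_of_monteCarloProp (hw i) hpe

/-- The invariant of the forward tree. -/
structure TreeInvariant (P : Problem n m) (s : State n) : Prop where
  mem_free : ∀ v ∈ s.Vfor, v ∈ P.Xfree
  connected : ∀ v ∈ s.Vfor, P.Connected s.Efor P.xstart v
  queue : ∀ p ∈ s.Q, p.1 ∈ s.Vfor
  start_mem : P.xstart ∈ s.Vfor
  goal_of_finished : s.finished → ∃ x ∈ P.Xgoal, x ∈ s.Vfor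

lemma TreeInvariant.success_of_mem {s : State n} (hs : TreeInvariant P s) {x : E n}
    (hx : x ∈ P.Xgoal) (hxV : x ∈ s.Vfor) : Success P s :=
  ⟨x, hx, hxV, hs.connected x hxV⟩

lemma treeInvariant_initState (hstart : P.xstart ∈ P.Xfree) : TreeInvariant P (initState P) where
  mem_free v hv := by
    obtain rfl : v = P.xstart := by simpa [initState] using hv
    exact hstart
  connected v hv := by
    obtain rfl : v = P.xstart := by simpa [initState] using hv
    exact Relation.ReflTransGen.refl
  queue p hp := by simp [initState] at hp
  start_mem := by simp [initState]
  goal_of_finished h := h.elim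

lemma Problem.Connected.mono {𝓔 𝓔' : Set (Traj n)} (h : 𝓔 ⊆ 𝓔') {a b : E n}
    (hab : P.Connected 𝓔 a b) : P.Connected 𝓔' a b :=
  Relation.ReflTransGen.mono (fun _ _ ⟨e, he, h'⟩ => ⟨e, h he, h'⟩) _ _ hab

lemma TreeInvariant.of_queue {s s' : State n} (hs : TreeInvariant P s) (hV : s'.Vfor = s.Vfor)
    (hE : s'.Efor = s.Efor) (hF : s'.finished = s.finished)
    (hQ : ∀ p ∈ s'.Q, p.1 ∈ s.Vfor) : TreeInvariant P s' := by
  refine ⟨?_, ?_, ?_, ?_, ?_⟩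
  · rw [hV]; exact hs.mem_free
  · rw [hV, hE]; exact hs.connected
  · rw [hV]; exact hQ
  · rw [hV]; exact hs.start_mem
  · rw [hV, hF]; exact hs.goal_of_finished

lemma updatePQueueND_spec (r : ℝ) (x : E n) (s : State n) :
    (updatePQueueND A r x s).Vfor = s.Vfor ∧ (updatePQueueND A r x s).Efor = s.Efor ∧
      (updatePQueueND A r x s).finished = s.finished ∧
      ∀ p ∈ (updatePQueueND A r x s).Q, ∃ p' ∈ s.Q, p'.1 = p.1 := by
  unfold updatePQueueND
  split
  · exact ⟨rfl, rfl, rfl, fun p hp => ⟨p, hp, rfl⟩⟩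
  · split
    · refine ⟨rfl, rfl, rfl, fun p hp => ?_⟩
      obtain ⟨p', hp', rfl⟩ := List.mem_map.1 hp
      refine ⟨p', hp', ?_⟩
      split_ifs <;> rfl
    · exact ⟨rfl, rfl, rfl, fun p hp => ⟨p, hp, rfl⟩⟩

lemma revExpand_spec (r : ℝ) (w : Sample n m A.NB) (s : State n) :
    (revExpand P A r w s).Vfor = s.Vfor ∧ (revExpand P A r w s).Efor = s.Efor ∧
      (revExpand P A r w s).finished = s.finished ∧
      ∀ p ∈ (revExpand P A r w s).Q, ∃ p' ∈ s.Q, p'.1 = p.1 := by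
  unfold revExpand
  split
  · exact ⟨rfl, rfl, rfl, fun p hp => ⟨p, hp, rfl⟩⟩
  · dsimp only
    split
    · exact updatePQueueND_spec _ _ _
    · exact ⟨rfl, rfl, rfl, fun p hp => ⟨p, hp, rfl⟩⟩

lemma insertToPQueueND_spec (r : ℝ) (x : E n) (s : State n) :
    (insertToPQueueND A r x s).Vfor = s.Vfor ∧ (insertToPQueueND A r x s).Efor = s.Efor ∧
      (insertToPQueueND A r x s).finished = s.finished ∧
      ∀ p ∈ (insertToPQueueND A r x s).Q, p ∈ s.Q ∨ p.1 = x := by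
  unfold insertToPQueueND
  split
  · exact ⟨rfl, rfl, rfl, fun p hp => Or.inl hp⟩
  · split
    · refine ⟨rfl, rfl, rfl, fun p hp => ?_⟩
      rcases List.mem_cons.1 hp with rfl | hp
      · exact Or.inr rfl
      · exact Or.inl hp
    · exact ⟨rfl, rfl, rfl, fun p hp => Or.inl hp⟩

lemma pop_spec {Q Q' : List (E n × ℝ)} {x : E n} (h : pop Q = some (x, Q')) :
    (∃ p ∈ Q, p.1 = x) ∧ ∀ p ∈ Q', p ∈ Q := by
  unfold pop at h
  obtain ⟨p, hp, hpe⟩ := Option.map_eq_some_iff.1 h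
  obtain ⟨rfl, rfl⟩ := Prod.mk.inj hpe
  exact ⟨⟨p, List.argmin_mem hp, rfl⟩, fun p' hp' => List.mem_of_mem_erase hp'⟩

lemma isPropagation_of_forSrchFastExplore {s : State n} {w : Sample n m A.NB} {e : Traj n}
    (hw : IsValidSample P w) (h : forSrchFastExplore P A s w = some e) :
    ∃ x ∈ s.Vfor, IsPropagation P x e := by
  obtain ⟨x, hx, hxe⟩ := Option.bind_eq_some_iff.1 h
  exact ⟨x, List.argmin_mem hx, isPropagation_of_bestInputProp hw.2.1 hxe⟩

lemma isPropagation_of_forSrchRandomExplore {s : State n} {w : Sample n m A.NB} {e : Traj n}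
    (hw : IsValidSample P w) (h : forSrchRandomExplore P A s w = some e) :
    ∃ x ∈ s.Vfor, IsPropagation P x e := by
  obtain ⟨x, hx, hxe⟩ := Option.bind_eq_some_iff.1 h
  exact ⟨x, List.argmin_mem hx, isPropagation_of_monteCarloProp hw.2.2 hxe⟩

lemma exploitOrFast_spec {q r : ℝ} {s : State n} {w : Sample n m A.NB} (hw : IsValidSample P w)
    (hQ : ∀ p ∈ s.Q, p.1 ∈ s.Vfor) :
    (∀ e, (exploitOrFast P A q r w s).1 = some e → ∃ x ∈ s.Vfor, IsPropagation P x e) ∧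
      ∀ p ∈ (exploitOrFast P A q r w s).2, p ∈ s.Q := by
  unfold exploitOrFast
  split
  · split
    · exact ⟨fun e he => isPropagation_of_forSrchFastExplore hw he, fun p hp => hp⟩
    · rename_i x Q' hpop
      obtain ⟨⟨p, hp, rfl⟩, hQ'⟩ := pop_spec hpop
      refine ⟨fun e he => ?_, hQ'⟩
      rcases Option.or_eq_some_iff.1 he with he | ⟨_, he⟩
      · obtain ⟨y, _, hye⟩ := Option.bind_eq_some_iff.1 he
        exact ⟨p.1, hQ p hp, isPropagation_of_bestInputProp hw.1 hye⟩
      · exact isPropagation_of_forSrchFastExplore hw he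
  · exact ⟨fun e he => by simp at he, fun p hp => hp⟩

lemma subset_Vfor_addForward (r : ℝ) (e : Traj n) (s : State n) {v : E n} (hv : v ∈ s.Vfor) :
    v ∈ (addForward P A r e s).Vfor := by
  unfold addForward
  dsimp only
  split_ifs
  · exact List.mem_insert_iff.2 (Or.inr hv)
  · rw [(insertToPQueueND_spec _ _ _).1]
    exact List.mem_insert_iff.2 (Or.inr hv)
  · exact hv

lemma final_mem_Vfor_addForward (r : ℝ) {e : Traj n} (he : P.CollisionFree e) (s : State n) :
    e.final ∈ (addForward P A r e s).Vfor := by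
  unfold addForward
  dsimp only
  split_ifs
  · exact List.mem_insert_iff.2 (Or.inl rfl)
  · rw [(insertToPQueueND_spec _ _ _).1]
    exact List.mem_insert_iff.2 (Or.inl rfl)

lemma IsPropagation.isValid {x : E n} {e : Traj n} (he : IsPropagation P x e)
    (hc : P.CollisionFree e) : P.IsValid e := by
  obtain ⟨_, h0, u, hu, hI⟩ := he
  exact ⟨h0, hc, fun _ => u, measurable_const, fun _ _ => hu, hI⟩

lemma TreeInvariant.addForward {s : State n} (hs : TreeInvariant P s) (r : ℝ) {x : E n}
    (hx : x ∈ s.Vfor) {e : Traj n} (he : IsPropagation P x e) :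
    TreeInvariant P (addForward P A r e s) := by
  unfold GABRRT.addForward
  dsimp only
  split_ifs with hc hg
  all_goals try exact hs
  all_goals
    have hfree : e.final ∈ P.Xfree := hc _ ⟨he.2.1, le_rfl⟩
    have hconn : P.Connected (insert e s.Efor) P.xstart e.final :=
      ((hs.connected x hx).mono (Set.subset_insert _ _)).tail
        ⟨e, Set.mem_insert _ _, he.isValid hc, he.1, rfl⟩
    have hconn' : ∀ v, v = e.final ∨ v ∈ s.Vfor → P.Connected (insert e s.Efor) P.xstart v := by
      rintro v (rfl | hv)
      · exact hconn
      · exact (hs.connected v hv).mono (Set.subset_insert _ _)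
    have hfree' : ∀ v, v = e.final ∨ v ∈ s.Vfor → v ∈ P.Xfree := by
      rintro v (rfl | hv)
      · exact hfree
      · exact hs.mem_free v hv
  · exact ⟨fun v hv => hfree' v (List.mem_insert_iff.1 hv),
      fun v hv => hconn' v (List.mem_insert_iff.1 hv),
      fun p hp => List.mem_insert_iff.2 (Or.inr (hs.queue p hp)),
      List.mem_insert_iff.2 (Or.inr hs.start_mem),
      fun _ => ⟨e.final, hg, List.mem_insert_iff.2 (Or.inl rfl)⟩⟩
  · obtain ⟨h1, h2, h3, h4⟩ := insertToPQueueND_spec (A := A) r e.final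
      { s with
        Vfor := s.Vfor.insert e.final
        Efor := insert e s.Efor
        g := Function.update s.g e.final (s.g e.init + A.cost e) }
    refine ⟨?_, ?_, ?_, ?_, ?_⟩
    · rw [h1]; exact fun v hv => hfree' v (List.mem_insert_iff.1 hv)
    · rw [h1, h2]; exact fun v hv => hconn' v (List.mem_insert_iff.1 hv)
    · rw [h1]
      intro p hp
      rcases h4 p hp with hp | hp
      · exact List.mem_insert_iff.2 (Or.inr (hs.queue p hp))
      · exact List.mem_insert_iff.2 (Or.inl hp)
    · rw [h1]; exact List.mem_insert_iff.2 (Or.inr hs.start_mem)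
    · rw [h1, h3]
      intro hf
      obtain ⟨y, hy, hyV⟩ := hs.goal_of_finished hf
      exact ⟨y, hy, List.mem_insert_iff.2 (Or.inr hyV)⟩

lemma TreeInvariant.step {s : State n} (hs : TreeInvariant P s) (k : ℕ) {w : Sample n m A.NB}
    (hw : IsValidSample P w) : TreeInvariant P (step P A k w s) := by
  unfold GABRRT.step
  split_ifs with hf
  · exact hs
  obtain ⟨h1, h2, h3, h4⟩ := revExpand_spec (P := P) (radius A s) w s
  have hs' : TreeInvariant P (revExpand P A (radius A s) w s) :=
    hs.of_queue h1 h2 h3 fun p hp => by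
      obtain ⟨p', hp', hpp⟩ := h4 p hp
      exact hpp ▸ hs.queue p' hp'
  set t := revExpand P A (radius A s) w s
  obtain ⟨he, hQ⟩ := exploitOrFast_spec (q := A.ratio k) (r := radius A s) hw hs'.queue
  have hs'' : TreeInvariant P
      { t with Q := (exploitOrFast P A (A.ratio k) (radius A s) w t).2 } :=
    hs'.of_queue rfl rfl rfl fun p hp => hs'.queue p (hQ p hp)
  unfold forExpand
  dsimp only
  split
  · exact hs''
  · rename_i e hsome
    have : ∃ x ∈ t.Vfor, IsPropagation P x e := by
      rcases Option.or_eq_some_iff.1 hsome with h | ⟨_, h⟩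
      · exact he e h
      · exact isPropagation_of_forSrchRandomExplore hw h
    obtain ⟨x, hx, hxe⟩ := this
    exact hs''.addForward _ hx hxe

lemma subset_Vfor_step (k : ℕ) (w : Sample n m A.NB) {s : State n} {v : E n}
    (hv : v ∈ s.Vfor) : v ∈ (step P A k w s).Vfor := by
  unfold step
  split_ifs with hf
  · exact hv
  have hv' : v ∈ (revExpand P A (radius A s) w s).Vfor := by
    rw [(revExpand_spec _ _ _).1]; exact hv
  unfold forExpand
  dsimp only
  split
  · exact hv'
  · exact subset_Vfor_addForward _ _ _ hv'

lemma final_mem_Vfor_step (k : ℕ) {w : Sample n m A.NB} {s : State n} (hf : ¬ s.finished)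
    (hc : A.ratio k ≤ w.c) {x : E n} (hx : (s.Vfor.argmin fun v => A.dX v w.xRand) = some x)
    {e : Traj n} (he : monteCarloProp P x w.rand = some e) (hce : P.CollisionFree e) :
    e.final ∈ (step P A k w s).Vfor := by
  have hV := (revExpand_spec (P := P) (radius A s) w s).1
  have h1 : (exploitOrFast P A (A.ratio k) (radius A s) w
      (revExpand P A (radius A s) w s)).1 = none := by
    unfold exploitOrFast
    rw [if_neg hc.not_gt]
  have h2 : forSrchRandomExplore P A (revExpand P A (radius A s) w s) w = some e := by
    unfold forSrchRandomExplore
    rw [hV, hx]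
    exact he
  unfold step
  rw [if_neg hf]
  unfold forExpand
  dsimp only
  rw [h1, h2]
  exact final_mem_Vfor_addForward _ hce _

/-- The forward tree has a goal node, or a node at distance less than `r` from `z`. -/
def Attains (P : Problem n m) (z : E n) (r : ℝ) (s : State n) : Prop :=
  (∃ x ∈ P.Xgoal, x ∈ s.Vfor) ∨ ∃ v ∈ s.Vfor, ‖v - z‖ < r

lemma Attains.step {z : E n} {r : ℝ} {s : State n} (h : Attains P z r s) (k : ℕ)
    (w : Sample n m A.NB) : Attains P z r (step P A k w s) := by
  rcases h with ⟨x, hx, hxV⟩ | ⟨v, hv, hvz⟩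
  · exact Or.inl ⟨x, hx, subset_Vfor_step k w hxV⟩
  · exact Or.inr ⟨v, subset_Vfor_step k w hv, hvz⟩

lemma Attains.run {z : E n} {r : ℝ} {ξ : ℕ → Sample n m A.NB} {N N' : ℕ} (hN : N ≤ N')
    (h : Attains P z r (run P A ξ N)) : Attains P z r (run P A ξ N') := by
  induction N', hN using Nat.le_induction with
  | base => exact h
  | succ k _ ih => exact ih.step _ _

lemma treeInvariant_run (hstart : P.xstart ∈ P.Xfree) {ξ : ℕ → Sample n m A.NB}
    (hξ : ∀ k, IsValidSample P (ξ k)) (N : ℕ) : TreeInvariant P (run P A ξ N) := by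
  induction N with
  | zero => exact treeInvariant_initState hstart
  | succ k ih => exact ih.step _ (hξ k)

end Invariants

end GABRRT

namespace GABRRT

/-! ### Laws of the draws -/

section Laws

variable {n m : ℕ} {P : Problem n m} {A : Params n}

lemma Problem.Admissible.volume_U_ne_zero (hP : P.Admissible) : volume P.U ≠ 0 := by
  obtain ⟨u, hu⟩ := hP.U_nonempty
  exact ((hP.volume_U_pos u hu 1 one_pos).trans_le (measure_mono Set.inter_subset_left)).ne'

lemma isProbabilityMeasure_stateLaw (hP : P.Admissible) (hX : volume P.X ≠ 0) :
    IsProbabilityMeasure (stateLaw P) :=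
  cond_isProbabilityMeasure_of_finite hX hP.volume_X_lt_top.ne

lemma isProbabilityMeasure_cond_Icc {T : ℝ} (hT : 0 < T) :
    IsProbabilityMeasure (cond (volume : Measure ℝ) (Set.Icc (0 : ℝ) T)) :=
  cond_isProbabilityMeasure_of_finite (by simpa using hT) (by simp)

lemma isProbabilityMeasure_cond_U (hP : P.Admissible) :
    IsProbabilityMeasure (cond volume P.U) :=
  cond_isProbabilityMeasure_of_finite hP.volume_U_ne_zero hP.volume_U_lt_top.ne

lemma isProbabilityMeasure_propLaw (hP : P.Admissible) (hA : A.Admissible P.X) :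
    IsProbabilityMeasure (propLaw P A) := by
  have := isProbabilityMeasure_cond_Icc hA.Tmax_pos
  have := isProbabilityMeasure_cond_U hP
  unfold propLaw
  infer_instance

lemma ae_isPropDraw (hP : P.Admissible) (hA : A.Admissible P.X) :
    ∀ᵐ p ∂propLaw P A, IsPropDraw P p := by
  have := isProbabilityMeasure_cond_Icc hA.Tmax_pos
  have := isProbabilityMeasure_cond_U hP
  have h1 : ∀ᵐ p ∂propLaw P A, p.1 ∈ Set.Icc 0 A.Tmax :=
    Measure.quasiMeasurePreserving_fst.ae (ae_cond_mem measurableSet_Icc)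
  have h2 : ∀ᵐ p ∂propLaw P A, p.2 ∈ P.U :=
    Measure.quasiMeasurePreserving_snd.ae (ae_cond_mem hP.measurableSet_U)
  filter_upwards [h1, h2] with p hp1 hp2 using ⟨hp1.1, hp2⟩

lemma ae_isValidSample (hP : P.Admissible) (hX : volume P.X ≠ 0) (hA : A.Admissible P.X) :
    ∀ᵐ w ∂sampleLaw P A, IsValidSample P w := by
  have := isProbabilityMeasure_stateLaw hP hX
  have := isProbabilityMeasure_cond_Icc one_pos
  have := isProbabilityMeasure_propLaw hP hA
  have h0 := ae_isPropDraw hP hA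
  have hpi : ∀ᵐ w ∂Measure.pi fun _ : Fin A.NB => propLaw P A, ∀ i, IsPropDraw P (w i) :=
    ae_all_iff.2 fun i => (Measure.quasiMeasurePreserving_eval _ i).ae h0
  have h1 : ∀ᵐ w ∂sampleLaw P A, ∀ i, IsPropDraw P (w.2.2.1 i) :=
    Measure.quasiMeasurePreserving_snd.ae (Measure.quasiMeasurePreserving_snd.ae
      (Measure.quasiMeasurePreserving_fst.ae hpi))
  have h2 : ∀ᵐ w ∂sampleLaw P A, ∀ i, IsPropDraw P (w.2.2.2.1.2 i) :=
    Measure.quasiMeasurePreserving_snd.ae (Measure.quasiMeasurePreserving_snd.ae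
      (Measure.quasiMeasurePreserving_snd.ae (Measure.quasiMeasurePreserving_fst.ae
        (Measure.quasiMeasurePreserving_snd.ae hpi))))
  have h3 : ∀ᵐ w ∂sampleLaw P A, IsPropDraw P w.2.2.2.2.2 :=
    Measure.quasiMeasurePreserving_snd.ae (Measure.quasiMeasurePreserving_snd.ae
      (Measure.quasiMeasurePreserving_snd.ae (Measure.quasiMeasurePreserving_snd.ae
        (Measure.quasiMeasurePreserving_snd.ae h0))))
  filter_upwards [h1, h2, h3] with w hw1 hw2 hw3 using ⟨hw1, hw2, hw3⟩

/-- The draws for which `c_rand ≥ q` and the random exploration uses a random state in `B`, a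
duration in `I` and a control in `V`. -/
def exploreSet (n m N : ℕ) (q : ℝ) (B : Set (E n)) (I : Set ℝ) (V : Set (E m)) :
    Set (Sample n m N) :=
  Set.univ ×ˢ (Set.Ici q ×ˢ (Set.univ ×ˢ (Set.univ ×ˢ (B ×ˢ (I ×ˢ V)))))

lemma measurableSet_exploreSet {N : ℕ} (q : ℝ) {B : Set (E n)} {I : Set ℝ} {V : Set (E m)}
    (hB : MeasurableSet B) (hI : MeasurableSet I) (hV : MeasurableSet V) :
    MeasurableSet (exploreSet n m N q B I V) :=
  MeasurableSet.univ.prod (measurableSet_Ici.prod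
    (MeasurableSet.univ.prod (MeasurableSet.univ.prod (hB.prod (hI.prod hV)))))

lemma cond_Icc_Ici {q : ℝ} (hq0 : 0 ≤ q) :
    cond (volume : Measure ℝ) (Set.Icc (0 : ℝ) 1) (Set.Ici q) = ENNReal.ofReal (1 - q) := by
  rw [cond_apply measurableSet_Icc]
  have : Set.Icc (0 : ℝ) 1 ∩ Set.Ici q = Set.Icc q 1 := by
    ext x
    simp only [Set.mem_inter_iff, Set.mem_Icc, Set.mem_Ici]
    exact ⟨fun h => ⟨h.2, h.1.2⟩, fun h => ⟨⟨hq0.trans h.1, h.2⟩, h.1⟩⟩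
  rw [this]
  simp

lemma sampleLaw_exploreSet (hP : P.Admissible) (hX : volume P.X ≠ 0) (hA : A.Admissible P.X)
    {q : ℝ} (hq0 : 0 ≤ q) (B : Set (E n)) (I : Set ℝ) (V : Set (E m)) :
    sampleLaw P A (exploreSet n m A.NB q B I V) = ENNReal.ofReal (1 - q) *
      (stateLaw P B * (cond volume (Set.Icc (0 : ℝ) A.Tmax) I * cond volume P.U V)) := by
  have := isProbabilityMeasure_stateLaw hP hX
  have := isProbabilityMeasure_cond_Icc one_pos
  have := isProbabilityMeasure_cond_Icc hA.Tmax_pos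
  have := isProbabilityMeasure_cond_U hP
  have := isProbabilityMeasure_propLaw hP hA
  rw [sampleLaw, exploreSet, Measure.prod_prod, Measure.prod_prod, Measure.prod_prod,
    Measure.prod_prod, Measure.prod_prod, cond_Icc_Ici hq0]
  simp only [measure_univ, one_mul]
  rw [propLaw, Measure.prod_prod]

lemma cond_ne_zero_of_inter_ne_zero {α : Type*} [MeasurableSpace α] {ν : Measure α} {s t : Set α}
    (hs : MeasurableSet s) (hs' : ν s ≠ ⊤) (h : ν (s ∩ t) ≠ 0) : cond ν s t ≠ 0 := by
  rw [cond_apply hs]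
  exact mul_ne_zero (ENNReal.inv_ne_zero.2 hs') h

lemma sampleLaw_setOf_le_c (hP : P.Admissible) (hX : volume P.X ≠ 0)
    (hA : A.Admissible P.X) {q : ℝ} (hq0 : 0 ≤ q) :
    sampleLaw P A {w | q ≤ w.c} = ENNReal.ofReal (1 - q) := by
  have := isProbabilityMeasure_stateLaw hP hX
  have := isProbabilityMeasure_cond_Icc hA.Tmax_pos
  have := isProbabilityMeasure_cond_U hP
  have h : {w : Sample n m A.NB | q ≤ w.c} =
      exploreSet n m A.NB q Set.univ Set.univ Set.univ := by
    ext w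
    simp [exploreSet, Sample.c, Set.mem_prod]
  rw [h, sampleLaw_exploreSet hP hX hA hq0]
  simp only [measure_univ, mul_one]

end Laws

/-! ### Almost sure attainment of neighbourhoods -/

section Reachable

variable {n m : ℕ} {P : Problem n m} {A : Params n} {Ω : Type*} [MeasurableSpace Ω]
  {μ : Measure Ω} {ξ : ℕ → Ω → Sample n m A.NB}

/-- Almost surely, every neighbourhood of `z` eventually contains a node of the forward tree, unless
a goal node is found. The algorithm involves distance and cost functions without any
measurability, so attainment need not be an event; it is witnessed by an increasing sequence of
measurable events `S N`, on which it has taken place after `N` iterations. -/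
def AlmostSurelyAttained (P : Problem n m) (A : Params n) (μ : Measure Ω)
    (ξ : ℕ → Ω → Sample n m A.NB) (z : E n) : Prop :=
  ∀ r : ℝ, 0 < r → ∃ S : ℕ → Set Ω, (∀ N, MeasurableSet (S N)) ∧ Monotone S ∧
    (∀ᵐ ω ∂μ, ∃ N, ω ∈ S N) ∧
    ∀ᵐ ω ∂μ, ∀ N, ω ∈ S N → Attains P z r (run P A (fun i => ξ i ω) N)

lemma almostSurelyAttained_start : AlmostSurelyAttained P A μ ξ P.xstart := fun r hr =>
  ⟨fun _ => Set.univ, fun _ => .univ, fun _ _ _ => le_rfl,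
    Eventually.of_forall fun _ => ⟨0, trivial⟩, Eventually.of_forall fun ω N _ =>
      Attains.run (Nat.zero_le N) (Or.inr ⟨P.xstart, by simp [run, initState], by simpa using hr⟩)⟩

/-- The second Borel–Cantelli lemma for independent draws with a common law. -/
lemma ae_frequently_mem {α : Type*} [MeasurableSpace α] {ν : Measure α} {ζ : ℕ → Ω → α}
    (hζ : ∀ k, Measurable (ζ k)) (hlaw : ∀ k, Measure.map (ζ k) μ = ν) (hind : iIndepFun ζ μ)
    {G : Set α} (hG : MeasurableSet G) (hG0 : ν G ≠ 0) :
    ∀ᵐ ω ∂μ, ∃ᶠ k in atTop, ζ k ω ∈ G := by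
  have := hind.isProbabilityMeasure
  have hm : ∀ k, MeasurableSet (ζ k ⁻¹' G) := fun k => hζ k hG
  have hi : iIndepSet (fun k => ζ k ⁻¹' G) μ := by
    rw [iIndepSet_iff_meas_biInter hm]
    exact fun s => hind.measure_inter_preimage_eq_mul s (sets := fun _ => G) fun _ _ => hG
  have hsum : ∑' k, μ (ζ k ⁻¹' G) = ⊤ := by
    have : ∀ k, μ (ζ k ⁻¹' G) = ν G := fun k => by
      rw [← hlaw k, Measure.map_apply (hζ k) hG]
    simp only [this]
    exact ENNReal.tsum_const_eq_top_of_ne_zero hG0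
  have h1 := measure_limsup_eq_one hm hi hsum
  have h2 : ∀ᵐ ω ∂μ, ω ∈ limsup (fun k => ζ k ⁻¹' G) atTop := by
    rw [ae_iff]
    have := (prob_compl_eq_zero_iff (μ := μ)
      (MeasurableSet.measurableSet_limsup hm)).2 h1
    exact this
  filter_upwards [h2] with ω hω
  rwa [mem_limsup_iff_frequently_mem] at hω

/-- If every draw in some set of positive probability lets the tree pass from a neighbourhood of
`z` to a prescribed neighbourhood of `z'`, then attainment is inherited by `z'`: such draws occur
infinitely often, and once a neighbourhood is attained it stays so. -/
lemma AlmostSurelyAttained.of_step (hξ : ∀ k, Measurable (ξ k))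
    (hlaw : ∀ k, Measure.map (ξ k) μ = sampleLaw P A) (hind : iIndepFun ξ μ)
    (hinv : ∀ᵐ ω ∂μ, ∀ N, TreeInvariant P (run P A (fun i => ξ i ω) N)) {z z' : E n}
    (hz : AlmostSurelyAttained P A μ ξ z)
    (H : ∀ r' : ℝ, 0 < r' → ∃ r : ℝ, 0 < r ∧ ∃ G : Set (Sample n m A.NB), MeasurableSet G ∧
      sampleLaw P A G ≠ 0 ∧ ∀ (k : ℕ) (s : State n) (w : Sample n m A.NB), TreeInvariant P s →
        1 ≤ k → Attains P z r s → w ∈ G → Attains P z' r' (step P A k w s)) :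
    AlmostSurelyAttained P A μ ξ z' := by
  intro r' hr'
  obtain ⟨r, hr, G, hG, hG0, hstep⟩ := H r' hr'
  obtain ⟨S, hSm, hSmono, hSex, hS⟩ := hz r hr
  refine ⟨fun N => ⋃ k ∈ Set.Iio N, S k ∩ ξ k ⁻¹' G, fun N => ?_, fun N N' hN => ?_, ?_, ?_⟩
  · exact MeasurableSet.biUnion (Set.to_countable _) fun k _ => (hSm k).inter (hξ k hG)
  · exact Set.biUnion_subset_biUnion_left fun k hk => lt_of_lt_of_le hk hN
  · filter_upwards [hSex, ae_frequently_mem hξ hlaw hind hG hG0] with ω ⟨N, hN⟩ hfreq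
    obtain ⟨k, hk, hkG⟩ := (frequently_atTop.1 hfreq) N
    exact ⟨k + 1, Set.mem_biUnion (Set.mem_Iio.2 k.lt_succ_self) ⟨hSmono hk hN, hkG⟩⟩
  · filter_upwards [hS, hinv] with ω hω hi N hN
    simp only [Set.mem_iUnion] at hN
    obtain ⟨k, hk, hkS, hkG⟩ := hN
    exact Attains.run (Nat.succ_le_of_lt hk)
      (hstep (k + 1) _ _ (hi k) (Nat.le_add_left 1 k) (hω k hkS) hkG)

end Reachable

end GABRRT

namespace GABRRT

/-! ### Following a reference edge -/

section Follow

variable {n m : ℕ} {P : Problem n m} {A : Params n}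

/-- Propagations from near the start of a reference edge, with a control near the reference control
and a duration slightly shorter than that of the reference edge, are collision-free and end near
the end of the reference edge. -/
lemma exists_monteCarloProp_near (hP : P.Admissible) {K : NNReal}
    (hK : P.HasLipschitzExtension K) {u : E m} (hu : u ∈ P.U) {e : Traj n} (he0 : 0 < e.dur)
    (hKh : K * e.dur ≤ 1 / 2) (he : P.Integrates (fun _ => u) e) {δ : ℝ} (hδ : 0 < δ)
    (hclear : P.HasClearance e δ) {r : ℝ} (hr : 0 < r) :
    ∃ R > 0, ∃ η > 0, ∃ a : ℝ, 0 ≤ a ∧ a < e.dur ∧ ∀ x : E n, ‖x - e.init‖ < R →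
      ∀ t ∈ Set.Ioo a e.dur, ∀ v ∈ P.U, ‖v - u‖ < η →
        ∃ e', monteCarloProp P x (t, v) = some e' ∧ P.CollisionFree e' ∧
          ‖e'.final - e.final‖ < r := by
  obtain ⟨Ku, hKu, hLu⟩ := hP.lipschitz_control
  set h := e.dur with hh
  set C := Real.exp (2 * (K * h)) with hC
  have hC0 : 0 < C := Real.exp_pos _
  set ρ := min δ (r / 2) with hρ
  have hρ0 : 0 < ρ := lt_min hδ (half_pos hr)
  have hend : h ∈ Set.Icc 0 h := ⟨he0.le, le_rfl⟩
  obtain ⟨d, hd, hdr⟩ := Metric.continuousWithinAt_iff.1 (he.1 h hend) (r / 2) (half_pos hr)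
  have heX : ∀ t ∈ Set.Icc 0 h, e.path t ∈ P.X := fun t ht =>
    (hclear t ht (Metric.mem_ball_self hδ)).1
  refine ⟨ρ / (4 * C), by positivity, ρ / (4 * C * Ku * h), by positivity, max 0 (h - d),
    le_max_left _ _, max_lt he0 (by linarith), fun x hx t ht v hv hvu => ?_⟩
  have ht0 : 0 < t := (le_max_left _ _).trans_lt ht.1
  have hdt : h - d < t := (le_max_right _ _).trans_lt ht.1
  have hth : t < h := ht.2
  have hsub : Set.Icc 0 t ⊆ Set.Icc 0 h := Set.Icc_subset_Icc_right hth.le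
  have hKt : (K : ℝ) * t ≤ K * h := mul_le_mul_of_nonneg_left hth.le K.2
  have hg : IntervalIntegrable (fun s => P.f (e.path s) u) volume 0 t :=
    he.2.1.mono_set (by
      rw [Set.uIcc_of_le ht0.le, Set.uIcc_of_le he0.le]; exact hsub)
  have hint : ∫ s in (0 : ℝ)..t, ‖P.f (e.path s) v - P.f (e.path s) u‖ ≤ ρ / (4 * C) := by
    have h1 : ‖∫ s in (0 : ℝ)..t, ‖P.f (e.path s) v - P.f (e.path s) u‖‖ ≤
        Ku * (ρ / (4 * C * Ku * h)) * |t - 0| := by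
      refine intervalIntegral.norm_integral_le_of_norm_le_const fun s hs => ?_
      rw [Set.uIoc_of_le ht0.le] at hs
      rw [norm_norm]
      exact (hLu _ (heX s (hsub ⟨hs.1.le, hs.2⟩)) v hv u hu).trans (by gcongr)
    rw [sub_zero, abs_of_pos ht0] at h1
    calc _ ≤ Ku * (ρ / (4 * C * Ku * h)) * t := (Real.le_norm_self _).trans h1
      _ ≤ Ku * (ρ / (4 * C * Ku * h)) * h := by gcongr
      _ = ρ / (4 * C) := by field_simp
  have hbound : Real.exp (2 * (K * t)) *
      (‖x - e.path 0‖ + ∫ s in (0 : ℝ)..t, ‖P.f (e.path s) v - P.f (e.path s) u‖) < ρ := by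
    have hx' : ‖x - e.path 0‖ ≤ ρ / (4 * C) := hx.le
    calc _ ≤ C * (ρ / (4 * C) + ρ / (4 * C)) := by
          refine mul_le_mul (Real.exp_le_exp.2 (by linarith)) (add_le_add hx' hint) ?_ hC0.le
          exact add_nonneg (norm_nonneg _)
            (intervalIntegral.integral_nonneg ht0.le fun _ _ => norm_nonneg _)
      _ = ρ / 2 := by field_simp; norm_num
      _ < ρ := half_lt_self hρ0
  have hinteq : ∀ s ∈ Set.Icc 0 t, e.path s = e.path 0 + ∫ τ in (0 : ℝ)..s, P.f (e.path τ) u :=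
    fun s hs => he.2.2 s (hsub hs)
  obtain ⟨e₁, h1, h2, h3, h4⟩ := hK.exists_integrates hv ht0.le (hKt.trans hKh)
    (he.1.mono hsub) hδ (fun s hs => hclear s (hsub hs)) hg hinteq
    (hbound.trans_le (min_le_left _ _))
  obtain ⟨e', he'⟩ := monteCarloProp_eq_some_of_exists (P := P) (x := x) (w := (t, v))
    ⟨e₁, h1, h2, fun s hs => (h4 s hs).1, h3⟩
  -- The propagation is an arbitrary solution, so closeness is derived afresh for it.
  obtain ⟨hdur, hinit, hX', hI'⟩ := monteCarloProp_spec he'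
  dsimp only at hdur hI'
  have hclose := hK.norm_sub_le_of_integrates hv (by rw [hdur]; exact ht0.le)
    (by rw [hdur]; exact hKt.trans hKh) hI' hX' (x := e.path) (g := fun s => P.f (e.path s) u)
    (by rw [hdur]; exact he.1.mono hsub) (by rw [hdur]; exact fun s hs => heX s (hsub hs))
    (by rw [hdur]; exact hg) (by rw [hdur]; exact hinteq)
  rw [hdur, hinit] at hclose
  refine ⟨e', he', fun s hs => ?_, ?_⟩
  · rw [hdur] at hs
    refine hclear s (hsub hs) ?_
    rw [Metric.mem_ball, dist_eq_norm]
    exact (hclose s hs).trans_lt (hbound.trans_le (min_le_left _ _))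
  · have h5 : ‖e'.path t - e.path t‖ < r / 2 :=
      (hclose t ⟨ht0.le, le_rfl⟩).trans_lt (hbound.trans_le (min_le_right _ _))
    have h6 : ‖e.path t - e.path h‖ < r / 2 := by
      have := hdr (x := t) ⟨ht0.le, hth.le⟩ (by
        rw [Real.dist_eq, abs_sub_lt_iff]; constructor <;> linarith)
      rwa [dist_eq_norm] at this
    change ‖e'.path e'.dur - e.path h‖ < r
    rw [hdur]
    calc _ = ‖(e'.path t - e.path t) + (e.path t - e.path h)‖ := by abel_nf
      _ ≤ _ := norm_add_le _ _
      _ < r := by linarith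

/-- If some forward node is very close to `z` and so is the random state, then the node nearest to
the random state with respect to `dX` is close to `z`. -/
lemma exists_argmin_near (hA : A.Admissible P.X) {z : E n} (hz : z ∈ P.X) {R : ℝ} (hR : 0 < R) :
    ∃ r > 0, ∀ s : State n, (∀ v ∈ s.Vfor, v ∈ P.X) → (∃ v ∈ s.Vfor, ‖v - z‖ < r) →
      ∀ y ∈ P.X, ‖y - z‖ < r →
        ∃ x, (s.Vfor.argmin fun v => A.dX v y) = some x ∧ ‖x - z‖ < R := by
  obtain ⟨η, hη, hnear⟩ := hA.near_of_small z hz R hR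
  obtain ⟨r, hr, hsmall⟩ := hA.small_near z hz (η / 2) (half_pos hη)
  refine ⟨r, hr, fun s hV ⟨v, hv, hvz⟩ y hy hyz => ?_⟩
  cases harg : s.Vfor.argmin fun v => A.dX v y with
  | none =>
    rw [List.argmin_eq_none] at harg
    simp [harg] at hv
  | some x =>
    have hx := hV x (List.argmin_mem harg)
    refine ⟨x, rfl, hnear x hx ?_⟩
    have h1 : A.dX x y ≤ A.dX v y := List.le_of_mem_argmin hv harg
    have h2 := hsmall v (hV v hv) y hy hvz hyz
    have h3 := hsmall y hy z hz hyz (by simpa using hr)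
    have h4 := hA.triangle x hx y hy z hz
    linarith

/-- Attainment is transported along an edge with a constant control and positive clearance. The
draws that achieve this form a fixed set of positive probability, independent of the state of
the algorithm. -/
lemma AlmostSurelyAttained.of_integrates (hP : P.Admissible) (hX : volume P.X ≠ 0)
    (hA : A.Admissible P.X) {q : ℝ} (hq0 : 0 ≤ q) (hq : q < 1)
    (hratio : ∀ k, 1 ≤ k → A.ratio k ≤ q)
    {Ω : Type*} [MeasurableSpace Ω] {μ : Measure Ω} {ξ : ℕ → Ω → Sample n m A.NB}
    (hξ : ∀ k, Measurable (ξ k)) (hlaw : ∀ k, Measure.map (ξ k) μ = sampleLaw P A)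
    (hind : iIndepFun ξ μ)
    (hinv : ∀ᵐ ω ∂μ, ∀ N, TreeInvariant P (run P A (fun i => ξ i ω) N))
    {K : NNReal} (hK : P.HasLipschitzExtension K) {u : E m} (hu : u ∈ P.U) {e : Traj n}
    (he0 : 0 < e.dur) (heT : e.dur ≤ A.Tmax) (hKh : K * e.dur ≤ 1 / 2)
    (he : P.Integrates (fun _ => u) e) {δ : ℝ} (hδ : 0 < δ) (hclear : P.HasClearance e δ)
    (hz : AlmostSurelyAttained P A μ ξ e.init) : AlmostSurelyAttained P A μ ξ e.final := by
  refine hz.of_step hξ hlaw hind hinv fun r' hr' => ?_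
  obtain ⟨R, hR, η, hη, a, ha0, hah, hprop⟩ :=
    exists_monteCarloProp_near hP hK hu he0 hKh he hδ hclear hr'
  have hball : Metric.ball e.init δ ⊆ P.X := fun y hy => (hclear 0 ⟨le_rfl, he0.le⟩ hy).1
  obtain ⟨r, hr, hnear⟩ := exists_argmin_near hA (hball (Metric.mem_ball_self hδ)) hR
  refine ⟨r, hr, exploreSet n m A.NB q (P.X ∩ Metric.ball e.init r) (Set.Ioo a e.dur)
    (P.U ∩ Metric.ball u η), ?_, ?_, ?_⟩
  · exact measurableSet_exploreSet q (hP.measurableSet_X.inter Metric.isOpen_ball.measurableSet)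
      measurableSet_Ioo (hP.measurableSet_U.inter Metric.isOpen_ball.measurableSet)
  · rw [sampleLaw_exploreSet hP hX hA hq0]
    refine mul_ne_zero (by simpa using hq) (mul_ne_zero ?_ (mul_ne_zero ?_ ?_))
    · refine cond_ne_zero_of_inter_ne_zero hP.measurableSet_X hP.volume_X_lt_top.ne ?_
      rw [← Set.inter_assoc, Set.inter_self]
      have hsub : Metric.ball e.init (min δ r) ⊆ P.X ∩ Metric.ball e.init r := fun y hy =>
        ⟨hball (Metric.ball_subset_ball (min_le_left _ _) hy),
          Metric.ball_subset_ball (min_le_right _ _) hy⟩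
      exact ((Metric.measure_ball_pos volume _ (lt_min hδ hr)).trans_le (measure_mono hsub)).ne'
    · refine cond_ne_zero_of_inter_ne_zero measurableSet_Icc (by simp) ?_
      have hsub : Set.Ioo a e.dur ⊆ Set.Icc 0 A.Tmax := fun t ht =>
        ⟨ha0.trans ht.1.le, ht.2.le.trans heT⟩
      rw [Set.inter_eq_right.2 hsub]
      simpa using hah
    · refine cond_ne_zero_of_inter_ne_zero hP.measurableSet_U hP.volume_U_lt_top.ne ?_
      rw [← Set.inter_assoc, Set.inter_self]
      exact (hP.volume_U_pos u hu η hη).ne'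
  · intro k s w hs hk hatt hw
    obtain ⟨-, hc, -, -, ⟨hyX, hy⟩, ht, hvU, hv⟩ := hw
    rw [Metric.mem_ball, dist_eq_norm] at hy hv
    rcases hatt with hgoal | hatt
    · exact Attains.step (Or.inl hgoal) k w
    by_cases hf : s.finished
    · exact Attains.step (Or.inl (hs.goal_of_finished hf)) k w
    obtain ⟨x, hx, hxR⟩ := hnear s (fun v hv => (hs.mem_free v hv).1) hatt w.xRand hyX hy
    obtain ⟨e', he', hcf, hfin⟩ := hprop x hxR w.rand.1 ht w.rand.2 hvU hv
    exact Or.inr ⟨e'.final, final_mem_Vfor_step k hf ((hratio k hk).trans hc) hx he' hcf, hfin⟩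

end Follow

end GABRRT

namespace GABRRT

/-! ### Piecewise constant controls -/

section Approximation

variable {n m : ℕ} {P : Problem n m}

/-- A measurable control is replaced on each short interval by one of its own values `υ s₀`. The
mismatch of velocities is controlled by an integrable density `β` of small total mass. Only the
velocity `g s = f (x s, υ s)` has to be approximated by a continuous function `ψ`, not the control
itself, which may be unbounded: `s₀` is a time at which `‖g - ψ‖` does not exceed its mean, and
`f (x s, υ s₀)` is close to `f (x s₀, υ s₀) = g s₀`. -/
lemma exists_density_of_control {K : NNReal} (hK : P.HasLipschitzExtension K) {T : ℝ} (hT : 0 < T)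
    {x : ℝ → E n} {υ : ℝ → E m} (hxc : ContinuousOn x (Set.Icc 0 T))
    (hxX : ∀ t ∈ Set.Icc 0 T, x t ∈ P.X) (hυ : ∀ t ∈ Set.Icc 0 T, υ t ∈ P.U)
    (hg : IntervalIntegrable (fun s => P.f (x s) (υ s)) volume 0 T) {ε : ℝ} (hε : 0 < ε) :
    ∃ h₀ > 0, ∃ β : ℝ → ℝ, (∀ s, 0 ≤ β s) ∧ (∀ a b, IntervalIntegrable β volume a b) ∧
      ∫ s in (0 : ℝ)..T, β s ≤ ε ∧ ∀ a b, 0 ≤ a → a < b → b ≤ T → b - a < h₀ →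
        ∃ u ∈ P.U, ∫ s in a..b, ‖P.f (x s) u - P.f (x s) (υ s)‖ ≤ ∫ s in a..b, β s := by
  set g : ℝ → E n := fun s => P.f (x s) (υ s) with hgdef
  have hGi : Integrable ((Set.Ioc 0 T).indicator g) volume :=
    (integrable_indicator_iff measurableSet_Ioc).2
      ((intervalIntegrable_iff_integrableOn_Ioc_of_le hT.le).1 hg)
  set G := (Set.Ioc 0 T).indicator g with hG
  obtain ⟨ψ, hψs, hψi, hψc, hψI⟩ := hGi.exists_hasCompactSupport_integral_sub_le
    (show 0 < ε / 4 by positivity)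
  set c := ε / (2 * T) with hc
  have hc0 : 0 < c := by positivity
  obtain ⟨d₁, hd₁, hψu⟩ := Metric.uniformContinuous_iff.1
    (hψc.uniformContinuous_of_tendsto_cocompact hψs.is_zero_at_infty) (c / 2) (half_pos hc0)
  obtain ⟨d₂, hd₂, hxu⟩ := Metric.uniformContinuousOn_iff.1
    (isCompact_Icc.uniformContinuousOn_of_continuous hxc) (c / (2 * (K + 1))) (by positivity)
  have hφ : Integrable (fun s => ‖G s - ψ s‖) volume := (hGi.sub hψI).norm
  have hβi : ∀ a b, IntervalIntegrable (fun s => c + 2 * ‖G s - ψ s‖) volume a b := fun a b =>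
    intervalIntegrable_const.add (hφ.const_mul 2).intervalIntegrable
  refine ⟨min d₁ d₂, lt_min hd₁ hd₂, fun s => c + 2 * ‖G s - ψ s‖, fun s => by positivity, hβi,
    ?_, fun a b ha hab hb hlt => ?_⟩
  · have h1 : ∫ s in (0 : ℝ)..T, ‖G s - ψ s‖ ≤ ε / 4 := by
      rw [intervalIntegral.integral_of_le hT.le]
      exact (setIntegral_le_integral hφ (Eventually.of_forall fun s => norm_nonneg _)).trans hψi
    rw [intervalIntegral.integral_add intervalIntegrable_const
      (hφ.const_mul 2).intervalIntegrable, intervalIntegral.integral_const,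
      intervalIntegral.integral_const_mul, smul_eq_mul, sub_zero]
    have h2 : T * c = ε / 2 := by rw [hc]; field_simp
    linarith
  have hvol : volume (Set.Ioc a b) ≠ 0 := by simpa using hab
  obtain ⟨s₀, hs₀, hav⟩ := exists_le_setAverage hvol (by simp) hφ.integrableOn
  have hsubT : Set.Ioc a b ⊆ Set.Ioc 0 T := Set.Ioc_subset_Ioc ha hb
  have hsubI : ∀ s ∈ Set.Ioc a b, s ∈ Set.Icc 0 T := fun s hs =>
    Set.Ioc_subset_Icc_self (hsubT hs)
  have hGg : ∀ s ∈ Set.Ioc a b, G s = g s := fun s hs => Set.indicator_of_mem (hsubT hs) g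
  have hav' : (b - a) * ‖G s₀ - ψ s₀‖ ≤ ∫ s in a..b, ‖G s - ψ s‖ := by
    rw [setAverage_eq, smul_eq_mul, Real.volume_real_Ioc_of_le hab.le,
      ← intervalIntegral.integral_of_le hab.le] at hav
    calc _ ≤ (b - a) * ((b - a)⁻¹ * ∫ s in a..b, ‖G s - ψ s‖) :=
          mul_le_mul_of_nonneg_left hav (sub_nonneg.2 hab.le)
      _ = _ := by rw [← mul_assoc, mul_inv_cancel₀ (sub_pos.2 hab).ne', one_mul]
  have hu : υ s₀ ∈ P.U := hυ s₀ (hsubI s₀ hs₀)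
  have hLip := hK.norm_sub_le hu
  have hpt : ∀ s ∈ Set.Ioc a b,
      ‖P.f (x s) (υ s₀) - g s‖ ≤ c + ‖G s₀ - ψ s₀‖ + ‖G s - ψ s‖ := by
    intro s hs
    have hdist : dist s s₀ < min d₁ d₂ := by
      rw [Real.dist_eq]
      refine lt_of_le_of_lt ?_ hlt
      rw [abs_le]
      constructor <;> linarith [hs.1, hs.2, hs₀.1, hs₀.2]
    have k1 : ‖P.f (x s) (υ s₀) - g s₀‖ ≤ c / 2 := by
      have h1 := hLip _ (hxX s (hsubI s hs)) _ (hxX s₀ (hsubI s₀ hs₀))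
      have h2 := hxu s (hsubI s hs) s₀ (hsubI s₀ hs₀) (hdist.trans_le (min_le_right _ _))
      rw [dist_eq_norm] at h2
      calc _ ≤ (K : ℝ) * ‖x s - x s₀‖ := h1
        _ ≤ (K + 1) * (c / (2 * (K + 1))) := by gcongr; linarith
        _ = c / 2 := by field_simp
    have k2 : ‖ψ s₀ - ψ s‖ ≤ c / 2 := by
      rw [norm_sub_rev, ← dist_eq_norm]
      exact (hψu (hdist.trans_le (min_le_left _ _))).le
    have e : P.f (x s) (υ s₀) - g s = (P.f (x s) (υ s₀) - g s₀) + (G s₀ - ψ s₀) +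
        (ψ s₀ - ψ s) - (G s - ψ s) := by
      rw [hGg s hs, hGg s₀ hs₀]; abel
    rw [e]
    have := norm_sub_le ((P.f (x s) (υ s₀) - g s₀) + (G s₀ - ψ s₀) + (ψ s₀ - ψ s)) (G s - ψ s)
    have := norm_add₃_le (a := P.f (x s) (υ s₀) - g s₀) (b := G s₀ - ψ s₀) (c := ψ s₀ - ψ s)
    linarith
  refine ⟨υ s₀, hu, ?_⟩
  have hfx : IntervalIntegrable (fun s => P.f (x s) (υ s₀)) volume a b := by
    obtain ⟨F, hF, hFe⟩ := hK _ hu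
    have hsub : Set.Icc a b ⊆ Set.Icc 0 T := Set.Icc_subset_Icc ha hb
    refine ContinuousOn.intervalIntegrable_of_Icc hab.le ?_
    exact ((hF.continuous.comp_continuousOn hxc).mono hsub).congr fun s hs =>
      (hFe _ (hxX s (hsub hs))).symm
  have hgab : IntervalIntegrable g volume a b := hg.mono_set (by
    rw [Set.uIcc_of_le hab.le, Set.uIcc_of_le hT.le]; exact Set.Icc_subset_Icc ha hb)
  have hφi : IntervalIntegrable (fun s => ‖G s - ψ s‖) volume a b := hφ.intervalIntegrable
  calc ∫ s in a..b, ‖P.f (x s) (υ s₀) - g s‖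
      ≤ ∫ s in a..b, (c + ‖G s₀ - ψ s₀‖ + ‖G s - ψ s‖) := by
        refine intervalIntegral.integral_mono_on_of_le_Ioo hab.le (hfx.sub hgab).norm
          (intervalIntegrable_const.add hφi) fun s hs => hpt s ⟨hs.1, hs.2.le⟩
    _ ≤ ∫ s in a..b, (c + 2 * ‖G s - ψ s‖) := by
        rw [intervalIntegral.integral_add intervalIntegrable_const hφi,
          intervalIntegral.integral_add intervalIntegrable_const (hφi.const_mul 2),
          intervalIntegral.integral_const, intervalIntegral.integral_const,
          intervalIntegral.integral_const_mul, smul_eq_mul, smul_eq_mul]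
        linarith

end Approximation

/-! ### Probabilistic completeness -/

section Completeness

variable {n m : ℕ} {P : Problem n m} {A : Params n}

/-- Attainment at points arbitrarily close to the end of a trajectory with clearance: the
trajectory is followed by edges with constant controls, and the deviations accumulate to at
most `exp (2 * K * t)` times the mass of the density `β` on `[0, t]`. -/
lemma exists_almostSurelyAttained_near_final (hP : P.Admissible) (hX : volume P.X ≠ 0)
    (hA : A.Admissible P.X) {q : ℝ} (hq0 : 0 ≤ q) (hq : q < 1)
    (hratio : ∀ k, 1 ≤ k → A.ratio k ≤ q)
    {Ω : Type*} [MeasurableSpace Ω] {μ : Measure Ω} {ξ : ℕ → Ω → Sample n m A.NB}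
    (hξ : ∀ k, Measurable (ξ k)) (hlaw : ∀ k, Measure.map (ξ k) μ = sampleLaw P A)
    (hind : iIndepFun ξ μ)
    (hinv : ∀ᵐ ω ∂μ, ∀ N, TreeInvariant P (run P A (fun i => ξ i ω) N))
    {e : Traj n} (he : P.IsValid e) (hstart : e.init = P.xstart) {δ : ℝ} (hδ : 0 < δ)
    (hclear : P.HasClearance e δ) {r : ℝ} (hr : 0 < r) :
    ∃ z, ‖z - e.final‖ < r ∧ AlmostSurelyAttained P A μ ξ z := by
  obtain ⟨hT0, hcf, υ, -, hυ, hI⟩ := he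
  rcases hT0.eq_or_lt with hT | hT
  · refine ⟨P.xstart, ?_, almostSurelyAttained_start⟩
    rw [Traj.final, ← hT, ← hstart, Traj.init, sub_self, norm_zero]
    exact hr
  obtain ⟨K, hK⟩ := hP.exists_hasLipschitzExtension
  set T := e.dur with hTdef
  set C := Real.exp (2 * (K * T)) with hC
  have hC0 : 0 < C := Real.exp_pos _
  -- Deviations below `δ / 2` leave the edges of the approximating chain the clearance `δ / 2`.
  set ρ := min (δ / 2) r with hρ
  have hρ0 : 0 < ρ := lt_min (half_pos hδ) hr
  have hxX : ∀ t ∈ Set.Icc 0 T, e.path t ∈ P.X := fun t ht => (hcf t ht).1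
  obtain ⟨h₀, hh₀, β, hβ0, hβi, hβT, hctrl⟩ := exists_density_of_control hK hT hI.1 hxX hυ hI.2.1
    (show 0 < ρ / (2 * C) by positivity)
  have hβle : ∀ t, 0 ≤ t → t ≤ T → ∫ s in (0 : ℝ)..t, β s ≤ ρ / (2 * C) := fun t ht htT =>
    (intervalIntegral.integral_mono_interval le_rfl ht htT (Eventually.of_forall hβ0)
      (hβi _ _)).trans hβT
  have hsmall : ∀ t, 0 ≤ t → t ≤ T →
      Real.exp (2 * (K * t)) * ∫ s in (0 : ℝ)..t, β s < ρ := fun t ht htT =>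
    calc _ ≤ C * (ρ / (2 * C)) := by
          refine mul_le_mul (Real.exp_le_exp.2 ?_) (hβle t ht htT)
            (intervalIntegral.integral_nonneg ht fun s _ => hβ0 s) hC0.le
          have : (K : ℝ) * t ≤ K * T := mul_le_mul_of_nonneg_left htT K.2
          linarith
      _ = ρ / 2 := by field_simp
      _ < ρ := half_lt_self hρ0
  have step : ∀ t t' : ℝ, 0 ≤ t → t < t' → t' ≤ T → t' - t < h₀ → t' - t ≤ A.Tmax →
      K * (t' - t) ≤ 1 / 2 →
      (∃ z, ‖z - e.path t‖ ≤ Real.exp (2 * (K * t)) * (∫ s in (0 : ℝ)..t, β s) ∧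
        AlmostSurelyAttained P A μ ξ z) →
      ∃ z, ‖z - e.path t'‖ ≤ Real.exp (2 * (K * t')) * (∫ s in (0 : ℝ)..t', β s) ∧
        AlmostSurelyAttained P A μ ξ z := by
    rintro t t' ht htt' ht' hlt hTmax hKh ⟨z, hz, hza⟩
    obtain ⟨u, hu, hint⟩ := hctrl t t' ht htt' ht' hlt
    set h := t' - t with hh
    have hh0 : 0 < h := sub_pos.2 htt'
    have hth : t + h = t' := by rw [hh]; ring
    have hmem : ∀ s ∈ Set.Icc 0 h, t + s ∈ Set.Icc 0 T := fun s hs =>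
      ⟨add_nonneg ht hs.1, by linarith [hs.2]⟩
    have hIcc : ∀ s ∈ Set.Icc 0 T, IntervalIntegrable (fun τ => P.f (e.path τ) (υ τ)) volume 0 s :=
      fun s hs => hI.2.1.mono_set (by
        rw [Set.uIcc_of_le hs.1, Set.uIcc_of_le hT.le]; exact Set.Icc_subset_Icc_right hs.2)
    have hxc : ContinuousOn (fun s => e.path (t + s)) (Set.Icc 0 h) :=
      hI.1.comp (by fun_prop) hmem
    have htT : t ∈ Set.Icc 0 T := ⟨ht, htt'.le.trans ht'⟩
    have hg : IntervalIntegrable (fun s => P.f (e.path (t + s)) (υ (t + s))) volume 0 h := by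
      have h1 : IntervalIntegrable (fun τ => P.f (e.path τ) (υ τ)) volume t t' :=
        (hIcc t htT).symm.trans (hIcc t' ⟨ht.trans htt'.le, ht'⟩)
      have h2 := h1.comp_add_left t
      rwa [sub_self] at h2
    have hx : ∀ s ∈ Set.Icc 0 h, e.path (t + s) = e.path (t + 0) +
        ∫ τ in (0 : ℝ)..s, P.f (e.path (t + τ)) (υ (t + τ)) := by
      intro s hs
      rw [intervalIntegral.integral_comp_add_left (fun τ => P.f (e.path τ) (υ τ)) t, add_zero,
        hI.2.2 _ (hmem s hs), hI.2.2 _ htT, add_assoc,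
        intervalIntegral.integral_add_adjacent_intervals (hIcc t htT)
          ((hIcc t htT).symm.trans (hIcc _ (hmem s hs)))]
    have hint' : ∫ s in (0 : ℝ)..h, ‖P.f (e.path (t + s)) u - P.f (e.path (t + s)) (υ (t + s))‖ ≤
        ∫ s in t..t', β s := by
      rw [intervalIntegral.integral_comp_add_left
        (fun τ => ‖P.f (e.path τ) u - P.f (e.path τ) (υ τ)‖) t, add_zero, hth]
      exact hint
    have hbound : Real.exp (2 * (K * h)) * (‖z - e.path (t + 0)‖ +
        ∫ s in (0 : ℝ)..h, ‖P.f (e.path (t + s)) u - P.f (e.path (t + s)) (υ (t + s))‖) ≤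
        Real.exp (2 * (K * t')) * ∫ s in (0 : ℝ)..t', β s := by
      rw [add_zero, ← intervalIntegral.integral_add_adjacent_intervals (hβi 0 t) (hβi t t')]
      have hexp : Real.exp (2 * (K * t')) = Real.exp (2 * (K * h)) * Real.exp (2 * (K * t)) := by
        rw [← Real.exp_add, ← hth]; ring_nf
      have hone : 1 ≤ Real.exp (2 * (K * t)) :=
        Real.one_le_exp (mul_nonneg zero_le_two (mul_nonneg K.2 ht))
      have hnn : 0 ≤ ∫ s in t..t', β s :=
        intervalIntegral.integral_nonneg htt'.le fun s _ => hβ0 s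
      rw [hexp, mul_assoc]
      refine mul_le_mul_of_nonneg_left ?_ (Real.exp_pos _).le
      rw [mul_add]
      exact add_le_add hz (hint'.trans (le_mul_of_one_le_left hnn hone))
    have hlt' := hbound.trans_lt (hsmall t' (ht.trans htt'.le) ht')
    have hclear' : ∀ s ∈ Set.Icc 0 h, Metric.ball (e.path (t + s)) δ ⊆ P.Xfree :=
      fun s hs => hclear _ (hmem s hs)
    have hlt2 := hlt'.trans_le (min_le_left _ _)
    obtain ⟨e₁, hdur, hinit, hI₁, hcf₁⟩ := hK.exists_integrates hu hh0.le hKh hxc hδ hclear' hg hx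
      (hlt2.trans (half_lt_self hδ))
    have hclose := hK.norm_sub_le_of_integrates hu (by rw [hdur]; exact hh0.le)
      (by rw [hdur]; exact hKh) hI₁ (fun s hs => (hcf₁ s hs).1) (by rw [hdur]; exact hxc)
      (by rw [hdur]; exact fun s hs => hxX _ (hmem s hs)) (by rw [hdur]; exact hg)
      (by rw [hdur]; exact hx)
    rw [hdur, hinit] at hclose
    have hclear₁ : P.HasClearance e₁ (δ / 2) := by
      intro s hs
      rw [hdur] at hs
      refine (Metric.ball_subset_ball' ?_).trans (hclear' s hs)
      rw [dist_eq_norm]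
      linarith [hclose s hs]
    refine ⟨e₁.final, ?_, AlmostSurelyAttained.of_integrates hP hX hA hq0 hq hratio hξ hlaw hind
      hinv hK hu (by rw [hdur]; exact hh0) (by rw [hdur]; exact hTmax) (by rw [hdur]; exact hKh)
      hI₁ (half_pos hδ) hclear₁ (by rw [hinit]; exact hza)⟩
    have := (hclose h ⟨hh0.le, le_rfl⟩).trans hbound
    rwa [hth, ← hdur] at this
  -- A uniform partition of `[0, T]` fine enough for the three requirements on the step length.
  set h₁ := min (h₀ / 2) (min A.Tmax (1 / (2 * (K + 1)))) with hh₁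
  have hh₁0 : 0 < h₁ := lt_min (half_pos hh₀) (lt_min hA.Tmax_pos (by positivity))
  obtain ⟨L, hL⟩ := exists_nat_gt (T / h₁)
  have hL0 : (0 : ℝ) < L := (by positivity : 0 < T / h₁).trans hL
  have hTL0 : 0 < T / L := by positivity
  have hTL : T / L ≤ h₁ := by
    rw [div_le_iff₀ hL0]
    rw [div_lt_iff₀ hh₁0] at hL
    linarith
  have main : ∀ j : ℕ, j ≤ L → ∃ z, ‖z - e.path (j * (T / L))‖ ≤
      Real.exp (2 * (K * (j * (T / L)))) * (∫ s in (0 : ℝ)..(j * (T / L)), β s) ∧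
      AlmostSurelyAttained P A μ ξ z := by
    intro j
    induction j with
    | zero =>
      refine fun _ => ⟨P.xstart, ?_, almostSurelyAttained_start⟩
      simp [← hstart, Traj.init]
    | succ j ih =>
      intro hj
      have hj' : ((j + 1 : ℕ) : ℝ) * (T / L) - j * (T / L) = T / L := by push_cast; ring
      refine step _ _ (by positivity) (by linarith) ?_ ?_ ?_ ?_ (ih (Nat.le_of_succ_le hj))
      · calc ((j + 1 : ℕ) : ℝ) * (T / L) ≤ L * (T / L) := by gcongr
          _ = T := by field_simp
      · rw [hj']
        exact (hTL.trans (min_le_left _ _)).trans_lt (half_lt_self hh₀)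
      · rw [hj']
        exact hTL.trans ((min_le_right _ _).trans (min_le_left _ _))
      · rw [hj']
        have := hTL.trans ((min_le_right _ _).trans (min_le_right _ _))
        calc (K : ℝ) * (T / L) ≤ (K + 1) * (1 / (2 * (K + 1))) := by gcongr; linarith
          _ = 1 / 2 := by field_simp
  obtain ⟨z, hz, hza⟩ := main L le_rfl
  have hLT : (L : ℝ) * (T / L) = T := by field_simp
  rw [hLT] at hz
  exact ⟨z, hz.trans_lt ((hsmall T hT0 le_rfl).trans_le (min_le_right _ _)), hza⟩

end Completeness

end GABRRT

theorem mainTheorem2 {n m : ℕ} (P : GABRRT.Problem n m) (hP : P.Admissible)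
    (hsol : P.RobustlySolvable)
    (A : GABRRT.Params n) (hA : A.Admissible P.X)
    (q : ℝ) (hq : q < 1) (hratio : ∀ k, 1 ≤ k → 0 ≤ A.ratio k ∧ A.ratio k ≤ q)
    {Ω : Type*} [MeasurableSpace Ω] (μ : Measure Ω) [IsProbabilityMeasure μ]
    (ξ : ℕ → Ω → GABRRT.Sample n m A.NB) (hξ : ∀ k, Measurable (ξ k))
    (hlaw : ∀ k, Measure.map (ξ k) μ = GABRRT.sampleLaw P A)
    (hind : iIndepFun ξ μ) :
    (∀ k, ENNReal.ofReal (1 - q) ≤ μ {ω | GABRRT.UsesRandomExplore P A (k + 1) (ξ k ω)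
      (GABRRT.run P A (fun i => ξ i ω) k)}) ∧
    liminf (fun N => μ {ω | GABRRT.Success P (GABRRT.run P A (fun i => ξ i ω) N)}) atTop = 1 ∧
    Tendsto (fun N => μ {ω | ¬ GABRRT.Success P (GABRRT.run P A (fun i => ξ i ω) N)})
      atTop (𝓝 0) := by
  obtain ⟨e, he, hstart, hgoal, δ, hδ, hclear⟩ := hsol
  have hX : volume P.X ≠ 0 := by
    have hsub : Metric.ball (e.path 0) δ ⊆ P.X := fun y hy => (hclear 0 ⟨le_rfl, he.1⟩ hy).1
    exact ((Metric.measure_ball_pos volume _ hδ).trans_le (measure_mono hsub)).ne'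
  have hq0 : 0 ≤ q := (hratio 1 le_rfl).1.trans (hratio 1 le_rfl).2
  refine ⟨fun k => ?_, ?_⟩
  · obtain ⟨hr0, hrq⟩ := hratio (k + 1) (Nat.le_add_left 1 k)
    have hm : MeasurableSet {w : GABRRT.Sample n m A.NB | A.ratio (k + 1) ≤ w.c} :=
      measurableSet_le measurable_const measurable_snd.fst
    calc ENNReal.ofReal (1 - q) ≤ ENNReal.ofReal (1 - A.ratio (k + 1)) :=
          ENNReal.ofReal_le_ofReal (by linarith)
      _ = GABRRT.sampleLaw P A {w | A.ratio (k + 1) ≤ w.c} :=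
          (GABRRT.sampleLaw_setOf_le_c hP hX hA hr0).symm
      _ = μ {ω | A.ratio (k + 1) ≤ (ξ k ω).c} := by
          rw [← hlaw k, Measure.map_apply (hξ k) hm]
          rfl
      _ ≤ _ := measure_mono fun ω hω => Or.inl hω
  have hinv : ∀ᵐ ω ∂μ, ∀ N, GABRRT.TreeInvariant P (GABRRT.run P A (fun i => ξ i ω) N) := by
    have hvalid : ∀ᵐ ω ∂μ, ∀ k, GABRRT.IsValidSample P (ξ k ω) := ae_all_iff.2 fun k =>
      ae_of_ae_map (hξ k).aemeasurable (by rw [hlaw k]; exact GABRRT.ae_isValidSample hP hX hA)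
    filter_upwards [hvalid] with ω hω N using GABRRT.treeInvariant_run hP.start_mem hω N
  obtain ⟨r, hr, hrgoal⟩ := Metric.isOpen_iff.1 isOpen_interior _ hgoal
  obtain ⟨z, hz, hza⟩ := GABRRT.exists_almostSurelyAttained_near_final hP hX hA hq0 hq
    (fun k hk => (hratio k hk).2) hξ hlaw hind hinv he hstart hδ hclear hr
  obtain ⟨S, hSm, hSmono, hSex, hS⟩ := hza (r - ‖z - e.final‖) (sub_pos.2 hz)
  have hsucc : ∀ᵐ ω ∂μ, ∀ N, ω ∈ S N →
      GABRRT.Success P (GABRRT.run P A (fun i => ξ i ω) N) := by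
    filter_upwards [hS, hinv] with ω hω hi N hN
    rcases hω N hN with ⟨x, hx, hxV⟩ | ⟨v, hv, hvz⟩
    · exact (hi N).success_of_mem hx hxV
    · refine (hi N).success_of_mem (interior_subset (hrgoal ?_)) hv
      rw [Metric.mem_ball, dist_eq_norm]
      have := norm_sub_le_norm_sub_add_norm_sub v z e.final
      linarith
  have hfail : Tendsto (fun N => μ {ω | ¬ GABRRT.Success P
      (GABRRT.run P A (fun i => ξ i ω) N)}) atTop (𝓝 0) := by
    have h1 : Tendsto (fun N => μ (S N)ᶜ) atTop (𝓝 0) := by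
      have h2 := tendsto_measure_iInter_atTop (μ := μ) (s := fun N => (S N)ᶜ)
        (fun N => (hSm N).compl.nullMeasurableSet)
        (fun N N' h => Set.compl_subset_compl.2 (hSmono h)) ⟨0, measure_ne_top _ _⟩
      have h3 : μ (⋂ N, (S N)ᶜ) = 0 := by
        rw [← Set.compl_iUnion]
        refine measure_mono_null (fun ω hω => ?_) (ae_iff.1 hSex)
        simpa using hω
      rwa [h3] at h2
    refine tendsto_of_tendsto_of_tendsto_of_le_of_le tendsto_const_nhds h1
      (fun _ => zero_le) fun N => measure_mono_ae ?_
    filter_upwards [hsucc] with ω hω hfail hN using hfail (hω N hN)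
  refine ⟨Tendsto.liminf_eq ?_, hfail⟩
  -- The success events need not be measurable, so only subadditivity of `μ` relates their measure
  -- to that of the complements.
  have hsub : Tendsto (fun N => 1 - μ {ω | ¬ GABRRT.Success P
      (GABRRT.run P A (fun i => ξ i ω) N)}) atTop (𝓝 1) := by
    have := ENNReal.Tendsto.sub (tendsto_const_nhds (x := (1 : ENNReal))) hfail
      (Or.inl ENNReal.one_ne_top)
    rwa [tsub_zero] at this
  refine tendsto_of_tendsto_of_tendsto_of_le_of_le hsub tendsto_const_nhds (fun N => ?_)
    fun N => prob_le_one
  rw [tsub_le_iff_right, ← measure_univ (μ := μ)]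
  refine (measure_mono fun ω _ => ?_).trans (measure_union_le _ _)
  exact em _
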